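/- Let $H$ be a complex Hilbert space with $\dim H \ge 2$, and let $E(H)$ be the set of all bounded linear operators $A$ on $H$ with $0 \le A \le I$, ordered by the usual order of self-adjoint operators. Let $\phi : E(H) \to E(H)$ be a bijective map such that for all $A, B \in E(H)$ $$A \le B \iff \phi(A) \le \phi(B) \qquad\text{and}\qquad AB = 0 \iff \phi(A)\phi(B) = 0 .$$ Then there are an either unitary or antiunitary operator $U$ on $H$ and a real number $p < 1$ such that, with the function $f_p(x) = \dfrac{x}{xp + (1-p)}$ $(x \in [0,1])$, $$\phi(A) = U f_p(A) U^* \qquad \text{for all } A \in E(H),$$ where $f_p(A)$ is defined by the continuous functional calculus of $A$. -/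

import Mathlib

open scoped ComplexConjugate

noncomputable section

/-- The set `E(H)` of Hilbert space effects: the bounded operators `A` on `H` with `0 ≤ A ≤ I`
in the Loewner order. -/
abbrev HilbertEffect (H : Type*) [NormedAddCommGroup H] [InnerProductSpace ℂ H] : Type _ :=
  Set.Icc (0 : H →L[ℂ] H) 1

/-- `φ` preserves the order in both directions. -/
def PreservesOrderBoth {H : Type*} [NormedAddCommGroup H] [InnerProductSpace ℂ H]
    (φ : HilbertEffect H → HilbertEffect H) : Prop :=
  ∀ A B : HilbertEffect H, A ≤ B ↔ φ A ≤ φ B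

/-- `φ` preserves zero product in both directions. -/
def PreservesZeroProductBoth {H : Type*} [NormedAddCommGroup H] [InnerProductSpace ℂ H]
    (φ : HilbertEffect H → HilbertEffect H) : Prop :=
  ∀ A B : HilbertEffect H,
    (A : H →L[ℂ] H) * (B : H →L[ℂ] H) = 0 ↔ (φ A : H →L[ℂ] H) * (φ B : H →L[ℂ] H) = 0

/-- The function `f_p(x) = x / (x p + (1 - p))`. -/
def effectFun (p x : ℝ) : ℝ := x / (x * p + (1 - p))

/-- `U B U*` for a surjective isometry `U` of `H` that is linear (a unitary operator) or
conjugate-linear (an antiunitary operator). In both cases the adjoint `U*` is the inverse of `U`,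
and the composition is a linear operator. -/
def unitaryConj {H : Type*} [NormedAddCommGroup H] [InnerProductSpace ℂ H]
    {σ σ' : ℂ →+* ℂ} [RingHomInvPair σ σ'] [RingHomInvPair σ' σ]
    (U : H ≃ₛₗᵢ[σ] H) (B : H →L[ℂ] H) : H →L[ℂ] H :=
  ((U.toContinuousLinearEquiv : H →SL[σ] H).comp B).comp
    (U.symm.toContinuousLinearEquiv : H →SL[σ'] H)

end

/-! ### Rank one effects and the Loewner order. -/

noncomputable section

open InnerProductSpace ContinuousLinearMap

variable {H : Type*} [NormedAddCommGroup H] [InnerProductSpace ℂ H]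

/-! Write `P_x` for the projection onto the line of a unit vector `x`. An effect is determined by
the effects `(1 + u)⁻¹ P_x`, `u ≥ 0`, below it (`le_of_forall_scaledRankOne_le`), so it suffices to
know `φ` on these. This parameter is chosen because `f_p` acts on it as multiplication by `1 - p`.

The `P_x` are characterised by the order alone (`exists_eq_rankOne_iff`), so `φ` sends `(1 + u)⁻¹
P_x` to `(1 + G x u)⁻¹ P_{f x}`. Zero products control the complements `1 - P_v`, and thus the
effects `1 - P_v + (1 + u)⁻¹ P_v` (`IsRayAction.map_dampedAlong`). Such an effect dominates `(1 +
w)⁻¹ P_x` exactly when `u |⟨x, v⟩|² ≤ w`. Invariance of this relation gives the exchange law `G x (u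
d) = d' G v u`, with `d = |⟨x, v⟩|²` and `d' = |⟨f x, f v⟩|²`.

Applied twice, the law shows that, for fixed `x`, `d' = m d` with `m` monotone and multiplicative.
Orthogonality gives `m r + m (1 - r) = 1`, so `m` is additive and hence the identity
(`IsRayAction.sq_norm_inner`). Then `G x u = k u` with a single `k > 0`, and Wigner's theorem
provides `U` inducing `f` on lines. For `p = 1 - k`, the effects `φ A` and `U f_p(A) U*` dominate
the same multiples of rank one projections, so they agree (`IsRayAction.eq_unitaryConj`). -/

theorem re_inner_smul_rankOne (c : ℝ) (x z : H) :
    (inner ℂ z ((c • rankOne ℂ x x) z)).re = c * ‖inner ℂ x z‖ ^ 2 := by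
  have : (c • rankOne ℂ x x) z = (c : ℂ) • (inner ℂ x z • x) := by
    simp [rankOne_apply]
  rw [this, inner_smul_right, inner_smul_right, ← inner_conj_symm z x, Complex.mul_conj,
    Complex.normSq_eq_norm_sq]
  norm_cast

variable [CompleteSpace H]

theorem le_iff_re_inner_le {A B : H →L[ℂ] H} (hA : IsSelfAdjoint A) (hB : IsSelfAdjoint B) :
    A ≤ B ↔ ∀ z, (inner ℂ z (A z)).re ≤ (inner ℂ z (B z)).re := by
  rw [ContinuousLinearMap.le_def, isPositive_def', and_iff_right (hB.sub hA)]
  refine forall_congr' fun z => ?_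
  rw [reApplyInnerSelf_apply, inner_re_symm]
  simp [inner_sub_right]

omit [CompleteSpace H] in
theorem re_inner_le_of_le {A B : H →L[ℂ] H} (h : A ≤ B) (z : H) :
    (inner ℂ z (A z)).re ≤ (inner ℂ z (B z)).re := by
  have := ((ContinuousLinearMap.le_def A B).1 h).re_inner_nonneg_right z
  simpa [inner_sub_right] using this

theorem isSelfAdjoint_smul_rankOne (c : ℝ) (x : H) :
    IsSelfAdjoint (c • rankOne ℂ x x) := by
  have h : (c • rankOne ℂ x x : H →L[ℂ] H) = (c : ℂ) • rankOne ℂ x x := by ext z; simp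
  rw [h]
  exact IsSelfAdjoint.smul (R := ℂ) (A := H →L[ℂ] H) (Complex.conj_ofReal c)
    (isPositive_rankOne_self x).isSelfAdjoint

theorem smul_rankOne_nonneg {c : ℝ} (hc : 0 ≤ c) (x : H) : 0 ≤ c • rankOne ℂ x x := by
  rw [le_iff_re_inner_le (IsSelfAdjoint.zero _) (isSelfAdjoint_smul_rankOne c x)]
  intro z
  rw [re_inner_smul_rankOne]
  simp; positivity

/-- Cauchy–Schwarz for the semi-inner product `⟨z, A w⟩`, which is `⟨S z, S w⟩` for `S` the square
root of `A`. -/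
theorem norm_sq_inner_le_of_nonneg {A : H →L[ℂ] H} (hA : 0 ≤ A) (z w : H) :
    ‖inner ℂ z (A w)‖ ^ 2 ≤ (inner ℂ z (A z)).re * (inner ℂ w (A w)).re := by
  set S := CFC.sqrt A with hS
  have hSS : S * S = A := CFC.sqrt_mul_sqrt_self A hA
  have hsa : IsSelfAdjoint S := (CFC.sqrt_nonneg A).isSelfAdjoint
  have key (a b : H) : inner ℂ a (A b) = inner ℂ (S a) (S b) := by
    rw [← hSS]
    exact (hsa.isSymmetric a (S b)).symm
  rw [key, key, key]
  have h := norm_inner_le_norm (𝕜 := ℂ) (S z) (S w)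
  have h1 (a : H) : (inner ℂ a a).re = ‖a‖ ^ 2 := by
    simpa using inner_self_eq_norm_sq (𝕜 := ℂ) a
  rw [h1, h1, ← mul_pow]
  gcongr

theorem inner_apply_self_eq_ofReal {A : H →L[ℂ] H} (hA : IsSelfAdjoint A) (z : H) :
    inner ℂ z (A z) = ((inner ℂ z (A z)).re : ℂ) := by
  refine (Complex.conj_eq_iff_re.1 ?_).symm
  rw [inner_conj_symm]
  exact hA.isSymmetric z z

/-- Testing the quadratic forms at `w` gives necessity; Cauchy–Schwarz for the form of `A` shows
that no other vector imposes a stronger condition. -/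
theorem smul_rankOne_le_iff {A : H →L[ℂ] H} (hA : 0 ≤ A) {w x : H} (hw : A w = x) {c : ℝ}
    (hc : 0 ≤ c) : c • rankOne ℂ x x ≤ A ↔ c * (inner ℂ w x).re ≤ 1 := by
  have hn : 0 ≤ (inner ℂ w x).re := by
    simpa [hw] using re_inner_le_of_le hA w
  rw [le_iff_re_inner_le (isSelfAdjoint_smul_rankOne c x) hA.isSelfAdjoint]
  simp_rw [re_inner_smul_rankOne]
  constructor
  · intro h
    have h1 := h w
    have h2 := inner_apply_self_eq_ofReal hA.isSelfAdjoint w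
    rw [hw] at h1 h2
    rw [← inner_conj_symm, h2, Complex.conj_ofReal, Complex.norm_real, Real.norm_of_nonneg hn] at h1
    rw [Complex.ofReal_re] at h1
    rcases hn.eq_or_lt with h0 | h0
    · rw [← h0]; simp
    · nlinarith
  · intro h z
    have h1 := norm_sq_inner_le_of_nonneg hA z w
    rw [hw, norm_inner_symm] at h1
    have h2 : 0 ≤ (inner ℂ z (A z)).re := by simpa using re_inner_le_of_le hA z
    nlinarith [mul_le_mul_of_nonneg_left h1 hc, mul_le_mul_of_nonneg_right h h2]

theorem rankOne_le_one {x : H} (hx : ‖x‖ = 1) : rankOne ℂ x x ≤ 1 := by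
  have h := (smul_rankOne_le_iff (A := (1 : H →L[ℂ] H)) zero_le_one (w := x) (x := x) rfl
    (c := 1) zero_le_one).2
  have h1 : (inner ℂ x x).re = ‖x‖ ^ 2 := by
    simpa using inner_self_eq_norm_sq (𝕜 := ℂ) x
  rw [h1, hx] at h
  simpa using h

/-- The multiple `(1 + u)⁻¹` of the rank one operator of `x`. -/
def scaledRankOne (x : H) (u : ℝ) : H →L[ℂ] H := (1 + u)⁻¹ • rankOne ℂ x x

/-- The operator acting as `(1 + u)⁻¹` on the line of a unit vector `v`, and as the identity on
its orthogonal complement. -/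
def dampedAlong (v : H) (u : ℝ) : H →L[ℂ] H := 1 - (u / (1 + u)) • rankOne ℂ v v

omit [CompleteSpace H] in
theorem scaledRankOne_zero (x : H) : scaledRankOne x 0 = rankOne ℂ x x := by
  simp [scaledRankOne]

theorem scaledRankOne_mem_Icc {x : H} (hx : ‖x‖ = 1) {u : ℝ} (hu : 0 ≤ u) :
    scaledRankOne x u ∈ Set.Icc (0 : H →L[ℂ] H) 1 := by
  refine ⟨smul_rankOne_nonneg (by positivity) x, le_trans ?_ (rankOne_le_one hx)⟩
  have : rankOne ℂ x x - scaledRankOne x u = (u / (1 + u)) • rankOne ℂ x x := by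
    have : u / (1 + u) = 1 - (1 + u)⁻¹ := by field_simp; ring
    rw [this, sub_smul, one_smul]; rfl
  rw [← sub_nonneg, this]
  exact smul_rankOne_nonneg (by positivity) x

theorem dampedAlong_mem_Icc {x : H} (hx : ‖x‖ = 1) {u : ℝ} (hu : 0 ≤ u) :
    dampedAlong x u ∈ Set.Icc (0 : H →L[ℂ] H) 1 := by
  constructor
  · have : dampedAlong x u = (1 - rankOne ℂ x x) + scaledRankOne x u := by
      have : u / (1 + u) = 1 - (1 + u)⁻¹ := by field_simp; ring
      rw [dampedAlong, this, sub_smul, one_smul, scaledRankOne]; abel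
    rw [this]
    exact add_nonneg (sub_nonneg.2 (rankOne_le_one hx)) (scaledRankOne_mem_Icc hx hu).1
  · exact sub_le_self _ (smul_rankOne_nonneg (by positivity) x)

/-- The bridge from order to transition probabilities. The inverse of `dampedAlong v u` is `1 + u
P_v`, so the preimage of `x` is explicit and `smul_rankOne_le_iff` applies. -/
theorem scaledRankOne_le_dampedAlong_iff {x v : H} (hx : ‖x‖ = 1) (hv : ‖v‖ = 1) {u w : ℝ}
    (hu : 0 ≤ u) (hw : 0 ≤ w) :
    scaledRankOne x w ≤ dampedAlong v u ↔ u * ‖inner ℂ x v‖ ^ 2 ≤ w := by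
  have hvv : inner ℂ v v = (1 : ℂ) := by
    rw [inner_self_eq_norm_sq_to_K, hv]; simp
  have hxx : inner ℂ x x = (1 : ℂ) := by
    rw [inner_self_eq_norm_sq_to_K, hx]; simp
  have hB : dampedAlong v u (x + (u : ℂ) • inner ℂ v x • v) = x := by
    have h1 : ((1 : ℂ) + u) ≠ 0 := by norm_cast; positivity
    have : dampedAlong v u (x + (u : ℂ) • inner ℂ v x • v) =
      (x + (u : ℂ) • inner ℂ v x • v) -
        ((u / (1 + u) : ℝ) : ℂ) • inner ℂ v (x + (u : ℂ) • inner ℂ v x • v) • v := by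
      simp only [dampedAlong, sub_apply, smul_apply, rankOne_apply]
      rw [← Complex.coe_smul]
      rfl
    rw [this, inner_add_right, inner_smul_right, inner_smul_right, hvv]
    simp only [smul_smul]
    rw [add_sub_assoc, ← sub_smul]
    have : (u : ℂ) * inner ℂ v x - ((u / (1 + u) : ℝ) : ℂ) * (inner ℂ v x + u * (inner ℂ v x * 1))
        = 0 := by
      push_cast; field_simp; ring
    rw [this]; simp
  rw [scaledRankOne, smul_rankOne_le_iff (dampedAlong_mem_Icc hv hu).1 hB (by positivity)]
  have : (inner ℂ (x + (u : ℂ) • inner ℂ v x • v) x).re = 1 + u * ‖inner ℂ x v‖ ^ 2 := by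
    rw [inner_add_left, inner_smul_left, inner_smul_left, hxx, inner_conj_symm,
      ← inner_conj_symm v x, Complex.mul_conj, Complex.normSq_eq_norm_sq, Complex.conj_ofReal]
    norm_cast
  rw [this, inv_mul_le_iff₀ (by positivity)]
  constructor <;> intro h <;> linarith

/-- With `y = A z`, the operator `⟨z, y⟩⁻¹ |y⟩⟨y|` lies below `A` and its quadratic form touches
that of `A` at `z`; `x` is `y` normalised. -/
theorem exists_scaledRankOne_le {A : H →L[ℂ] H} (hA : A ∈ Set.Icc (0 : H →L[ℂ] H) 1) {z : H}
    (hz : A z ≠ 0) : ∃ x : H, ‖x‖ = 1 ∧ ∃ u : ℝ, 0 ≤ u ∧ A z = (‖A z‖ : ℂ) • x ∧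
      scaledRankOne x u ≤ A ∧ (inner ℂ z (A z)).re = (1 + u)⁻¹ * ‖inner ℂ x z‖ ^ 2 := by
  have hsa := hA.1.isSelfAdjoint
  set y := A z with hy
  have hn : 0 < ‖y‖ := norm_pos_iff.2 hz
  set a := (inner ℂ z y).re with ha
  have hzy : inner ℂ z y = (a : ℂ) := inner_apply_self_eq_ofReal hsa z
  have ha0 : 0 ≤ a := by simpa using re_inner_le_of_le hA.1 z
  have hapos : 0 < a := by
    refine ha0.lt_of_ne' fun h0 => hz ?_
    have := norm_sq_inner_le_of_nonneg hA.1 y z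
    rw [← hy, ← ha, h0, mul_zero] at this
    have h2 : ‖inner ℂ y y‖ = 0 := by nlinarith [norm_nonneg (inner ℂ y y)]
    simpa using h2
  have hle : a⁻¹ • rankOne ℂ y y ≤ A := by
    rw [smul_rankOne_le_iff hA.1 hy.symm (by positivity), ← ha]
    exact (inv_mul_cancel₀ hapos.ne').le
  -- This is what makes the parameter `a / ‖y‖ ^ 2 - 1` nonnegative; it comes from testing `a⁻¹
  -- |y⟩⟨y| ≤ 1` at `y`.
  have hnorm : ‖y‖ ^ 2 ≤ a := by
    have h1 := re_inner_le_of_le (hle.trans hA.2) y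
    have h2 : (inner ℂ y y).re = ‖y‖ ^ 2 := by simpa using inner_self_eq_norm_sq (𝕜 := ℂ) y
    rw [re_inner_smul_rankOne, show (1 : H →L[ℂ] H) y = y from rfl, h2, inner_self_eq_norm_sq_to_K] at h1
    simp only [Complex.coe_algebraMap, norm_pow, Complex.norm_real, norm_norm] at h1
    rw [inv_mul_le_iff₀ hapos] at h1
    have : 0 < ‖y‖ ^ 2 := by positivity
    nlinarith
  have hu : (1 + (a / ‖y‖ ^ 2 - 1))⁻¹ = a⁻¹ * ‖y‖ ^ 2 := by
    rw [add_sub_cancel, inv_div, div_eq_inv_mul]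
  have hx : y = (‖y‖ : ℂ) • ((‖y‖⁻¹ : ℝ) : ℂ) • y := by
    rw [smul_smul]; norm_cast; rw [mul_inv_cancel₀ hn.ne', one_smul]
  refine ⟨((‖y‖⁻¹ : ℝ) : ℂ) • y, ?_, a / ‖y‖ ^ 2 - 1, ?_, hx, ?_, ?_⟩
  · rw [norm_smul, Complex.norm_real, norm_inv, norm_norm, inv_mul_cancel₀ hn.ne']
  · rw [sub_nonneg, one_le_div (by positivity)]; exact hnorm
  · have : scaledRankOne (((‖y‖⁻¹ : ℝ) : ℂ) • y) (a / ‖y‖ ^ 2 - 1) = a⁻¹ • rankOne ℂ y y := by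
      rw [scaledRankOne, hu]
      ext w
      simp only [smul_apply, rankOne_apply, inner_smul_left, Complex.conj_ofReal, smul_smul,
        ← Complex.coe_smul]
      congr 1
      have : (‖y‖ : ℂ) ≠ 0 := by exact_mod_cast hn.ne'
      push_cast
      field_simp
    rw [this]; exact hle
  · rw [hu, inner_smul_left, ← inner_conj_symm y z, hzy, norm_mul]
    simp only [Complex.conj_ofReal, Complex.norm_real, norm_inv, norm_norm,
      Real.norm_of_nonneg ha0]
    field_simp

theorem le_of_forall_scaledRankOne_le {A B : H →L[ℂ] H} (hA : A ∈ Set.Icc (0 : H →L[ℂ] H) 1)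
    (hB : 0 ≤ B)
    (h : ∀ x : H, ‖x‖ = 1 → ∀ u : ℝ, 0 ≤ u → scaledRankOne x u ≤ A → scaledRankOne x u ≤ B) :
    A ≤ B := by
  rw [le_iff_re_inner_le hA.1.isSelfAdjoint hB.isSelfAdjoint]
  intro z
  by_cases hz : A z = 0
  · rw [hz]; simpa using re_inner_le_of_le hB z
  · obtain ⟨x, hx, u, hu, -, hle, heq⟩ := exists_scaledRankOne_le hA hz
    rw [heq, ← re_inner_smul_rankOne]
    exact re_inner_le_of_le (h x hx u hu hle) z

end

/-! ### Order characterisation of rank one projections. -/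

noncomputable section

open InnerProductSpace ContinuousLinearMap

variable {H : Type*} [NormedAddCommGroup H] [InnerProductSpace ℂ H]

theorem inner_self_eq_one_of_norm {x : H} (hx : ‖x‖ = 1) : inner ℂ x x = (1 : ℂ) := by
  rw [inner_self_eq_norm_sq_to_K, hx]; simp

theorem inner_sub_inner_smul {x : H} (hx : ‖x‖ = 1) (y : H) :
    inner ℂ x (y - inner ℂ x y • x) = 0 := by
  rw [inner_sub_right, inner_smul_right, inner_self_eq_one_of_norm hx]; simp

theorem rankOne_mul_eq_zero_iff {x : H} (hx : ‖x‖ = 1) (A : H →L[ℂ] H) :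
    rankOne ℂ x x * A = 0 ↔ ∀ z, inner ℂ x (A z) = 0 := by
  have hx0 : x ≠ 0 := by rintro rfl; simp at hx
  rw [ContinuousLinearMap.ext_iff]
  refine forall_congr' fun z => ?_
  have : (rankOne ℂ x x * A) z = inner ℂ x (A z) • x := rfl
  rw [this]
  simp [hx0]

theorem rankOne_mul_rankOne_eq_zero_iff {x y : H} (hx : ‖x‖ = 1) (hy : ‖y‖ = 1) :
    rankOne ℂ x x * rankOne ℂ y y = 0 ↔ inner ℂ x y = 0 := by
  have hy0 : y ≠ 0 := by rintro rfl; simp at hy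
  rw [rankOne_mul_eq_zero_iff hx]
  simp only [rankOne_apply, inner_smul_right, mul_eq_zero]
  refine ⟨fun h => (h y).resolve_left ?_, fun h _ => Or.inr h⟩
  simpa using hy0

theorem rankOne_smul_self {c : ℂ} (hc : ‖c‖ = 1) (y : H) :
    rankOne ℂ (c • y) (c • y) = rankOne ℂ y y := by
  ext z
  simp only [rankOne_apply, inner_smul_left, smul_smul]
  rw [mul_right_comm, mul_comm (conj c), Complex.mul_conj, Complex.normSq_eq_norm_sq, hc]
  simp

variable [CompleteSpace H]

theorem eq_smul_rankOne_of_forall_exists {B : H →L[ℂ] H} (hB : IsSelfAdjoint B) {x : H}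
    (hx : ‖x‖ = 1) (h : ∀ z, ∃ c : ℂ, B z = c • x) :
    B = (inner ℂ x (B x)).re • rankOne ℂ x x := by
  have hxx := inner_self_eq_one_of_norm hx
  have h1 (z : H) : B z = inner ℂ x (B z) • x := by
    obtain ⟨c, hc⟩ := h z
    rw [hc, inner_smul_right, hxx, mul_one]
  ext z
  rw [h1 z]
  have h2 : inner ℂ x (B z) = inner ℂ (B x) z := (hB.isSymmetric x z).symm
  rw [h2, h1 x, inner_smul_left, inner_conj_symm]
  have h3 : inner ℂ (B x) x = inner ℂ x (B x) := hB.isSymmetric x x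
  rw [h3, inner_apply_self_eq_ofReal hB x, inner_smul_right, hxx, mul_one, smul_apply,
    ← Complex.coe_smul, rankOne_apply, smul_smul, Complex.ofReal_re]

theorem apply_eq_zero_of_re_inner_nonpos {B : H →L[ℂ] H} (hB : 0 ≤ B) {z : H}
    (hz : (inner ℂ z (B z)).re ≤ 0) : B z = 0 := by
  have h1 := norm_sq_inner_le_of_nonneg hB (B z) z
  have h2 : 0 ≤ (inner ℂ (B z) (B (B z))).re := by simpa using re_inner_le_of_le hB (B z)
  have h4 : ‖inner ℂ (B z) (B z)‖ = 0 := by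
    nlinarith [norm_nonneg (inner ℂ (B z) (B z)), mul_nonneg h2 (neg_nonneg.2 hz)]
  simpa using h4

omit [CompleteSpace H] in
theorem re_inner_le_one {A : H →L[ℂ] H} (hA : A ≤ 1) {x : H} (hx : ‖x‖ = 1) :
    (inner ℂ x (A x)).re ≤ 1 := by
  have := re_inner_le_of_le hA x
  rwa [show (1 : H →L[ℂ] H) x = x from rfl, inner_self_eq_one_of_norm hx, Complex.one_re] at this

theorem exists_eq_scaledRankOne {B : H →L[ℂ] H} (hB : B ∈ Set.Icc (0 : H →L[ℂ] H) 1) (hB0 : B ≠ 0)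
    {x : H} (hx : ‖x‖ = 1) (h : ∀ z, ∃ c : ℂ, B z = c • x) :
    ∃ u : ℝ, 0 ≤ u ∧ B = scaledRankOne x u := by
  have h1 := eq_smul_rankOne_of_forall_exists hB.1.isSelfAdjoint hx h
  set a := (inner ℂ x (B x)).re with ha
  have ha0 : 0 ≤ a := by simpa using re_inner_le_of_le hB.1 x
  have ha1 : a ≤ 1 := re_inner_le_one hB.2 hx
  have hapos : 0 < a := ha0.lt_of_ne' fun h0 => hB0 (by rw [h1, h0, zero_smul])
  refine ⟨a⁻¹ - 1, sub_nonneg.2 ((one_le_inv₀ hapos).2 ha1), ?_⟩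
  rw [scaledRankOne, add_sub_cancel, inv_inv, ← h1]

/-- A positive operator below `P_x` has vanishing form on the complement of `x`, so it kills that
complement; by self-adjointness its range lies in the line of `x`. -/
theorem exists_eq_scaledRankOne_of_le {B : H →L[ℂ] H} (hB : B ∈ Set.Icc (0 : H →L[ℂ] H) 1)
    (hB0 : B ≠ 0) {x : H} (hx : ‖x‖ = 1) (h : B ≤ rankOne ℂ x x) :
    ∃ u : ℝ, 0 ≤ u ∧ B = scaledRankOne x u := by
  refine exists_eq_scaledRankOne hB hB0 hx fun z => ⟨inner ℂ x (B z), ?_⟩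
  set r := B z - inner ℂ x (B z) • x with hr
  have hxr : inner ℂ x r = 0 := inner_sub_inner_smul hx _
  have hBr : B r = 0 := by
    refine apply_eq_zero_of_re_inner_nonpos hB.1 ((re_inner_le_of_le h r).trans ?_)
    rw [rankOne_apply, hxr]; simp
  have h2 : inner ℂ r (B z) = 0 := by
    rw [← show inner ℂ (B r) z = inner ℂ r (B z) from hB.1.isSelfAdjoint.isSymmetric r z, hBr,
      inner_zero_left]
  have h3 : inner ℂ r r = (0 : ℂ) := by
    nth_rw 2 [hr]
    rw [inner_sub_right, inner_smul_right, h2, ← inner_conj_symm r x, hxr]; simp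
  exact sub_eq_zero.1 (inner_self_eq_zero.1 h3)

theorem scaledRankOne_le_scaledRankOne_iff {x : H} (hx : ‖x‖ = 1) {u w : ℝ} (hu : 0 ≤ u)
    (hw : 0 ≤ w) : scaledRankOne x w ≤ scaledRankOne x u ↔ u ≤ w := by
  have hiff : u ≤ w ↔ (1 + w)⁻¹ ≤ (1 + u)⁻¹ := by
    rw [inv_le_inv₀ (by positivity) (by positivity)]; simp
  rw [hiff]
  constructor
  · intro h
    have h1 := re_inner_le_of_le h x
    rw [scaledRankOne, scaledRankOne, re_inner_smul_rankOne, re_inner_smul_rankOne,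
      inner_self_eq_one_of_norm hx] at h1
    simpa using h1
  · intro h
    rw [← sub_nonneg, scaledRankOne, scaledRankOne, ← sub_smul]
    exact smul_rankOne_nonneg (sub_nonneg.2 h) x

omit [CompleteSpace H] in
theorem exists_eq_smul_of_scaledRankOne_le {x y : H} (hy : ‖y‖ = 1) {u w : ℝ} (hu : 0 ≤ u)
    (h : scaledRankOne x u ≤ scaledRankOne y w) : ∃ c : ℂ, x = c • y := by
  refine ⟨inner ℂ y x, ?_⟩
  set r := x - inner ℂ y x • y with hr
  have hyr : inner ℂ y r = 0 := inner_sub_inner_smul hy _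
  have h1 := re_inner_le_of_le h r
  rw [scaledRankOne, scaledRankOne, re_inner_smul_rankOne, re_inner_smul_rankOne, hyr] at h1
  have h2 : inner ℂ x r = 0 := by
    have : 0 < (1 + u)⁻¹ := by positivity
    have h3 : ‖inner ℂ x r‖ ^ 2 = 0 := by
      simp only [norm_zero] at h1
      nlinarith [sq_nonneg ‖inner ℂ x r‖]
    simpa using h3
  have h3 : inner ℂ r r = (0 : ℂ) := by
    nth_rw 1 [hr]
    rw [inner_sub_left, inner_smul_left, h2, hyr]; simp
  exact sub_eq_zero.1 (inner_self_eq_zero.1 h3)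

/-- A nonzero operator below which the effects are totally ordered. -/
def IsChainEffect (A : H →L[ℂ] H) : Prop :=
  A ≠ 0 ∧ ∀ B ∈ Set.Icc (0 : H →L[ℂ] H) 1, ∀ C ∈ Set.Icc (0 : H →L[ℂ] H) 1,
    B ≤ A → C ≤ A → B ≤ C ∨ C ≤ B

omit [CompleteSpace H] in
theorem scaledRankOne_ne_zero {x : H} (hx : ‖x‖ = 1) {u : ℝ} (hu : 0 ≤ u) :
    scaledRankOne x u ≠ 0 := by
  have hx0 : x ≠ 0 := by rintro rfl; simp at hx
  have : (1 + u)⁻¹ ≠ 0 := by positivity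
  simp [scaledRankOne, this, hx0]

theorem scaledRankOne_le_rankOne {x : H} (hx : ‖x‖ = 1) {u : ℝ} (hu : 0 ≤ u) :
    scaledRankOne x u ≤ rankOne ℂ x x := by
  rw [← scaledRankOne_zero, scaledRankOne_le_scaledRankOne_iff hx le_rfl hu]
  exact hu

theorem isChainEffect_scaledRankOne {x : H} (hx : ‖x‖ = 1) {u : ℝ} (hu : 0 ≤ u) :
    IsChainEffect (scaledRankOne x u) := by
  refine ⟨scaledRankOne_ne_zero hx hu, fun B hB C hC hBA hCA => ?_⟩
  have hle := scaledRankOne_le_rankOne hx hu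
  by_cases hB0 : B = 0
  · exact Or.inl (hB0 ▸ hC.1)
  by_cases hC0 : C = 0
  · exact Or.inr (hC0 ▸ hB.1)
  obtain ⟨b, hb, rfl⟩ := exists_eq_scaledRankOne_of_le hB hB0 hx (hBA.trans hle)
  obtain ⟨c, hc, rfl⟩ := exists_eq_scaledRankOne_of_le hC hC0 hx (hCA.trans hle)
  rw [scaledRankOne_le_scaledRankOne_iff hx hc hb, scaledRankOne_le_scaledRankOne_iff hx hb hc]
  exact le_total c b

/-- The rank one effects touching `A` at two vectors are comparable, hence carried by the same line.
So all values of `A` lie on one line. -/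
theorem IsChainEffect.exists_eq_scaledRankOne {A : H →L[ℂ] H}
    (hA : A ∈ Set.Icc (0 : H →L[ℂ] H) 1) (h : IsChainEffect A) :
    ∃ x : H, ‖x‖ = 1 ∧ ∃ u : ℝ, 0 ≤ u ∧ A = scaledRankOne x u := by
  obtain ⟨z, hz⟩ : ∃ z, A z ≠ 0 := by
    by_contra! h0
    exact h.1 (ContinuousLinearMap.ext h0)
  obtain ⟨x, hx, u, hu, -, hxu, -⟩ := exists_scaledRankOne_le hA hz
  refine ⟨x, hx, _root_.exists_eq_scaledRankOne hA h.1 hx fun z' => ?_⟩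
  by_cases hz' : A z' = 0
  · exact ⟨0, by rw [hz', zero_smul]⟩
  obtain ⟨y, hy, w, hw, heq, hyw, -⟩ := exists_scaledRankOne_le hA hz'
  rcases h.2 _ (scaledRankOne_mem_Icc hx hu) _ (scaledRankOne_mem_Icc hy hw) hxu hyw with h1 | h1
  · obtain ⟨c, hc⟩ := exists_eq_smul_of_scaledRankOne_le hy hu h1
    have hc0 : c ≠ 0 := by rintro rfl; simp [hc] at hx
    refine ⟨‖A z'‖ * c⁻¹, ?_⟩
    rw [hc, mul_smul, inv_smul_smul₀ hc0, ← heq]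
  · obtain ⟨c, hc⟩ := exists_eq_smul_of_scaledRankOne_le hx hw h1
    refine ⟨‖A z'‖ * c, ?_⟩
    rw [mul_smul, ← hc, ← heq]

/-- The right-hand side, maximality among chain effects, mentions only the order, so order
automorphisms preserve it. -/
theorem exists_eq_rankOne_iff {A : H →L[ℂ] H} (hA : A ∈ Set.Icc (0 : H →L[ℂ] H) 1) :
    (∃ x : H, ‖x‖ = 1 ∧ A = rankOne ℂ x x) ↔
      IsChainEffect A ∧ ∀ B ∈ Set.Icc (0 : H →L[ℂ] H) 1, IsChainEffect B → A ≤ B → A = B := by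
  constructor
  · rintro ⟨x, hx, rfl⟩
    refine ⟨scaledRankOne_zero x ▸ isChainEffect_scaledRankOne hx le_rfl, fun B hB hBc hle => ?_⟩
    obtain ⟨y, hy, w, hw, rfl⟩ := hBc.exists_eq_scaledRankOne hB
    rw [← scaledRankOne_zero] at hle
    obtain ⟨c, rfl⟩ := exists_eq_smul_of_scaledRankOne_le hy le_rfl hle
    rw [norm_smul, hy, mul_one] at hx
    rw [scaledRankOne_zero, rankOne_smul_self hx, ← scaledRankOne_zero] at hle
    rw [rankOne_smul_self hx]
    exact le_antisymm (scaledRankOne_zero y ▸ hle) (scaledRankOne_le_rankOne hy hw)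
  · rintro ⟨h1, h2⟩
    obtain ⟨x, hx, u, hu, rfl⟩ := h1.exists_eq_scaledRankOne hA
    refine ⟨x, hx, ?_⟩
    rw [← scaledRankOne_zero]
    exact h2 _ (scaledRankOne_mem_Icc hx le_rfl) (isChainEffect_scaledRankOne hx le_rfl)
      (scaledRankOne_zero x ▸ scaledRankOne_le_rankOne hx hu)

/-- Conjugating `B ≤ 1` by `1 - P_v` leaves `B` unchanged and turns `1` into `1 - P_v`. -/
theorem le_one_sub_rankOne {B : H →L[ℂ] H} (hB : B ∈ Set.Icc (0 : H →L[ℂ] H) 1) {v : H}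
    (hv : ‖v‖ = 1) (h : rankOne ℂ v v * B = 0) : B ≤ 1 - rankOne ℂ v v := by
  have hP : IsSelfAdjoint (rankOne ℂ v v) := (isPositive_rankOne_self v).isSelfAdjoint
  have hid : rankOne ℂ v v * rankOne ℂ v v = rankOne ℂ v v := isIdempotentElem_rankOne_self hv
  have h' : B * rankOne ℂ v v = 0 := by
    have := congrArg star h
    rwa [star_mul, hP.star_eq, hB.1.isSelfAdjoint.star_eq, star_zero] at this
  have hs : star (1 - rankOne ℂ v v) = 1 - rankOne ℂ v v := by
    rw [star_sub, star_one, hP.star_eq]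
  have h1 := star_left_conjugate_le_conjugate hB.2 (1 - rankOne ℂ v v)
  rw [hs, mul_one] at h1
  simpa [mul_sub, sub_mul, h, h', hid] using h1

omit [CompleteSpace H] in
theorem dampedAlong_eq (v : H) {u : ℝ} (hu : 0 ≤ u) :
    dampedAlong v u = (1 - rankOne ℂ v v) + scaledRankOne v u := by
  have : u / (1 + u) = 1 - (1 + u)⁻¹ := by field_simp; ring
  rw [dampedAlong, this, sub_smul, one_smul, scaledRankOne]; abel

theorem exists_eq_dampedAlong {B : H →L[ℂ] H} (hB : B ∈ Set.Icc (0 : H →L[ℂ] H) 1) {v : H}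
    (hv : ‖v‖ = 1) (hle : 1 - rankOne ℂ v v ≤ B) (hne : B ≠ 1 - rankOne ℂ v v) :
    ∃ u : ℝ, 0 ≤ u ∧ B = dampedAlong v u := by
  by_cases h0 : 1 - B = 0
  · exact ⟨0, le_rfl, by simp [dampedAlong, (sub_eq_zero.1 h0).symm]⟩
  obtain ⟨w, hw, hBw⟩ := exists_eq_scaledRankOne_of_le
    (⟨sub_nonneg.2 hB.2, sub_le_self _ hB.1⟩ : 1 - B ∈ Set.Icc (0 : H →L[ℂ] H) 1) h0 hv
    (sub_le_comm.1 hle)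
  have hB' : B = 1 - scaledRankOne v w := by rw [← hBw, sub_sub_cancel]
  have hw0 : w ≠ 0 := by
    rintro rfl
    rw [scaledRankOne_zero] at hB'
    exact hne hB'
  -- Solves `u / (1 + u) = (1 + w)⁻¹`; the excluded case `w = 0` would be `u = ∞`.
  refine ⟨w⁻¹, by positivity, ?_⟩
  rw [hB', dampedAlong, scaledRankOne]
  congr 2
  have : 0 < w := hw.lt_of_ne' hw0
  field_simp
  ring

end

/-! ### Action of an effect automorphism on rank one effects. -/

noncomputable section

open InnerProductSpace ContinuousLinearMap

variable {H : Type*} [NormedAddCommGroup H] [InnerProductSpace ℂ H]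

/-- A map of operators that restricts to a surjection of the effects preserving order and zero
products in both directions. -/
structure IsEffectAutomorphism (Φ : (H →L[ℂ] H) → (H →L[ℂ] H)) : Prop where
  mapsTo : ∀ A ∈ Set.Icc (0 : H →L[ℂ] H) 1, Φ A ∈ Set.Icc (0 : H →L[ℂ] H) 1
  surj : ∀ B ∈ Set.Icc (0 : H →L[ℂ] H) 1, ∃ A ∈ Set.Icc (0 : H →L[ℂ] H) 1, Φ A = B
  le_iff : ∀ A ∈ Set.Icc (0 : H →L[ℂ] H) 1, ∀ B ∈ Set.Icc (0 : H →L[ℂ] H) 1,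
    (Φ A ≤ Φ B ↔ A ≤ B)
  mul_eq_zero_iff : ∀ A ∈ Set.Icc (0 : H →L[ℂ] H) 1, ∀ B ∈ Set.Icc (0 : H →L[ℂ] H) 1,
    (Φ A * Φ B = 0 ↔ A * B = 0)

namespace IsEffectAutomorphism

variable {Φ : (H →L[ℂ] H) → (H →L[ℂ] H)} (hΦ : IsEffectAutomorphism Φ)
include hΦ

theorem injOn {A B : H →L[ℂ] H} (hA : A ∈ Set.Icc (0 : H →L[ℂ] H) 1)
    (hB : B ∈ Set.Icc (0 : H →L[ℂ] H) 1) (h : Φ A = Φ B) : A = B :=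
  le_antisymm ((hΦ.le_iff A hA B hB).1 h.le) ((hΦ.le_iff B hB A hA).1 h.ge)

variable [CompleteSpace H]

theorem map_zero : Φ 0 = 0 := by
  have h0 : (0 : H →L[ℂ] H) ∈ Set.Icc (0 : H →L[ℂ] H) 1 := ⟨le_rfl, zero_le_one⟩
  obtain ⟨C, hC, hC0⟩ := hΦ.surj 0 h0
  refine le_antisymm ?_ (hΦ.mapsTo 0 h0).1
  exact ((hΦ.le_iff 0 h0 C hC).2 hC.1).trans_eq hC0

theorem eq_zero_iff {A : H →L[ℂ] H} (hA : A ∈ Set.Icc (0 : H →L[ℂ] H) 1) : Φ A = 0 ↔ A = 0 := by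
  refine ⟨fun h => hΦ.injOn hA ⟨le_rfl, zero_le_one⟩ (h.trans hΦ.map_zero.symm), ?_⟩
  rintro rfl
  exact hΦ.map_zero

theorem isChainEffect_iff {A : H →L[ℂ] H} (hA : A ∈ Set.Icc (0 : H →L[ℂ] H) 1) :
    IsChainEffect (Φ A) ↔ IsChainEffect A := by
  rw [IsChainEffect, IsChainEffect, Ne, hΦ.eq_zero_iff hA]
  refine and_congr_right fun _ => ⟨fun h B hB C hC hBA hCA => ?_, fun h B hB C hC hBA hCA => ?_⟩
  · rw [← hΦ.le_iff B hB C hC, ← hΦ.le_iff C hC B hB]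
    exact h _ (hΦ.mapsTo B hB) _ (hΦ.mapsTo C hC) ((hΦ.le_iff B hB A hA).2 hBA)
      ((hΦ.le_iff C hC A hA).2 hCA)
  · obtain ⟨B, hB', rfl⟩ := hΦ.surj B hB
    obtain ⟨C, hC', rfl⟩ := hΦ.surj C hC
    rw [hΦ.le_iff B hB' C hC', hΦ.le_iff C hC' B hB']
    exact h B hB' C hC' ((hΦ.le_iff B hB' A hA).1 hBA) ((hΦ.le_iff C hC' A hA).1 hCA)

theorem exists_eq_rankOne_iff {A : H →L[ℂ] H} (hA : A ∈ Set.Icc (0 : H →L[ℂ] H) 1) :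
    (∃ y : H, ‖y‖ = 1 ∧ Φ A = rankOne ℂ y y) ↔ ∃ x : H, ‖x‖ = 1 ∧ A = rankOne ℂ x x := by
  rw [_root_.exists_eq_rankOne_iff hA, _root_.exists_eq_rankOne_iff (hΦ.mapsTo A hA),
    hΦ.isChainEffect_iff hA]
  refine and_congr_right fun _ => ⟨fun h B hB hBc hAB => ?_, fun h B hB hBc hAB => ?_⟩
  · exact hΦ.injOn hA hB (h _ (hΦ.mapsTo B hB) ((hΦ.isChainEffect_iff hB).2 hBc)
      ((hΦ.le_iff A hA B hB).2 hAB))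
  · obtain ⟨B, hB', rfl⟩ := hΦ.surj B hB
    rw [h B hB' ((hΦ.isChainEffect_iff hB').1 hBc) ((hΦ.le_iff A hA B hB').1 hAB)]

end IsEffectAutomorphism

theorem rankOne_mem_Icc [CompleteSpace H] {x : H} (hx : ‖x‖ = 1) :
    rankOne ℂ x x ∈ Set.Icc (0 : H →L[ℂ] H) 1 :=
  scaledRankOne_zero x ▸ scaledRankOne_mem_Icc hx le_rfl

/-- The action of `Φ` on rank one effects, through unit vectors and nonnegative scales. -/
structure IsRayAction (Φ : (H →L[ℂ] H) → (H →L[ℂ] H)) (f : H → H) (G : H → ℝ → ℝ) : Prop where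
  norm_eq : ∀ x, ‖x‖ = 1 → ‖f x‖ = 1
  map_rankOne : ∀ x, ‖x‖ = 1 → Φ (rankOne ℂ x x) = rankOne ℂ (f x) (f x)
  nonneg : ∀ x, ‖x‖ = 1 → ∀ u, 0 ≤ u → 0 ≤ G x u
  map_scaled : ∀ x, ‖x‖ = 1 → ∀ u, 0 ≤ u → Φ (scaledRankOne x u) = scaledRankOne (f x) (G x u)

theorem IsEffectAutomorphism.exists_isRayAction [CompleteSpace H]
    {Φ : (H →L[ℂ] H) → (H →L[ℂ] H)} (hΦ : IsEffectAutomorphism Φ) :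
    ∃ f G, IsRayAction Φ f G := by
  have h1 (x : H) : ∃ y, ‖x‖ = 1 → ‖y‖ = 1 ∧ Φ (rankOne ℂ x x) = rankOne ℂ y y := by
    by_cases hx : ‖x‖ = 1
    · obtain ⟨y, hy⟩ := (hΦ.exists_eq_rankOne_iff (rankOne_mem_Icc hx)).2 ⟨x, hx, rfl⟩
      exact ⟨y, fun _ => hy⟩
    · exact ⟨0, fun h => absurd h hx⟩
  choose f hf using h1
  have h2 (x : H) (u : ℝ) : ∃ w, ‖x‖ = 1 → 0 ≤ u →
      0 ≤ w ∧ Φ (scaledRankOne x u) = scaledRankOne (f x) w := by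
    by_cases hx : ‖x‖ = 1 ∧ 0 ≤ u
    · have hm := scaledRankOne_mem_Icc hx.1 hx.2
      obtain ⟨w, hw⟩ := exists_eq_scaledRankOne_of_le (hΦ.mapsTo _ hm)
        (fun h => scaledRankOne_ne_zero hx.1 hx.2 ((hΦ.eq_zero_iff hm).1 h)) (hf x hx.1).1
        ((hf x hx.1).2 ▸ (hΦ.le_iff _ hm _ (rankOne_mem_Icc hx.1)).2
          (scaledRankOne_le_rankOne hx.1 hx.2))
      exact ⟨w, fun _ _ => hw⟩
    · exact ⟨0, fun h h' => absurd ⟨h, h'⟩ hx⟩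
  choose G hG using h2
  exact ⟨f, G, fun x hx => (hf x hx).1, fun x hx => (hf x hx).2,
    fun x hx u hu => (hG x u hx hu).1, fun x hx u hu => (hG x u hx hu).2⟩

namespace IsRayAction

variable [CompleteSpace H] {Φ : (H →L[ℂ] H) → (H →L[ℂ] H)} {f : H → H} {G : H → ℝ → ℝ}
  (hf : IsRayAction Φ f G) (hΦ : IsEffectAutomorphism Φ)
include hf hΦ

theorem le_iff {x : H} (hx : ‖x‖ = 1) {u w : ℝ} (hu : 0 ≤ u) (hw : 0 ≤ w) :
    G x u ≤ G x w ↔ u ≤ w := by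
  rw [← scaledRankOne_le_scaledRankOne_iff hx hu hw, ← hΦ.le_iff _ (scaledRankOne_mem_Icc hx hw) _
    (scaledRankOne_mem_Icc hx hu), hf.map_scaled x hx u hu, hf.map_scaled x hx w hw,
    scaledRankOne_le_scaledRankOne_iff (hf.norm_eq x hx) (hf.nonneg x hx u hu)
      (hf.nonneg x hx w hw)]

theorem surj {x : H} (hx : ‖x‖ = 1) {w : ℝ} (hw : 0 ≤ w) : ∃ u, 0 ≤ u ∧ G x u = w := by
  have hy := hf.norm_eq x hx
  obtain ⟨A, hA, hAw⟩ := hΦ.surj _ (scaledRankOne_mem_Icc hy hw)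
  obtain ⟨u, hu, rfl⟩ := exists_eq_scaledRankOne_of_le hA
    (fun h => scaledRankOne_ne_zero hy hw (hAw ▸ (hΦ.eq_zero_iff hA).2 h)) hx (by
      rw [← hΦ.le_iff A hA _ (rankOne_mem_Icc hx), hAw, hf.map_rankOne x hx]
      exact scaledRankOne_le_rankOne hy hw)
  refine ⟨u, hu, ?_⟩
  rw [hf.map_scaled x hx u hu] at hAw
  refine le_antisymm ?_ ?_
  · rw [← scaledRankOne_le_scaledRankOne_iff hy (hf.nonneg x hx u hu) hw, hAw]
  · rw [← scaledRankOne_le_scaledRankOne_iff hy hw (hf.nonneg x hx u hu), hAw]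

theorem exists_rankOne_eq {y : H} (hy : ‖y‖ = 1) :
    ∃ x, ‖x‖ = 1 ∧ rankOne ℂ (f x) (f x) = rankOne ℂ y y := by
  obtain ⟨A, hA, hAy⟩ := hΦ.surj _ (rankOne_mem_Icc hy)
  obtain ⟨x, hx, rfl⟩ := (hΦ.exists_eq_rankOne_iff hA).1 ⟨y, hy, hAy⟩
  exact ⟨x, hx, by rw [← hf.map_rankOne x hx, hAy]⟩

theorem inner_eq_zero_iff {x y : H} (hx : ‖x‖ = 1) (hy : ‖y‖ = 1) :
    inner ℂ (f x) (f y) = 0 ↔ inner ℂ x y = 0 := by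
  rw [← rankOne_mul_rankOne_eq_zero_iff hx hy, ← hΦ.mul_eq_zero_iff _ (rankOne_mem_Icc hx) _
    (rankOne_mem_Icc hy), hf.map_rankOne x hx, hf.map_rankOne y hy,
    rankOne_mul_rankOne_eq_zero_iff (hf.norm_eq x hx) (hf.norm_eq y hy)]

/-- Preservation of zero products puts the preimage of `1 - P_{f v}` below `1 - P_v`, so the image
lies above `1 - P_{f v}` and is damped along `f v`. Its parameter is read off from the multiples of
`P_{f v}` below it. -/
theorem map_dampedAlong {v : H} (hv : ‖v‖ = 1) {u : ℝ} (hu : 0 ≤ u) :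
    Φ (dampedAlong v u) = dampedAlong (f v) (G v u) := by
  have hy := hf.norm_eq v hv
  have hm := dampedAlong_mem_Icc hv hu
  have hPy := rankOne_mem_Icc hy
  obtain ⟨C, hC, hCy⟩ := hΦ.surj (1 - rankOne ℂ (f v) (f v))
    ⟨sub_nonneg.2 hPy.2, sub_le_self _ hPy.1⟩
  have hidem : rankOne ℂ (f v) (f v) * rankOne ℂ (f v) (f v) = rankOne ℂ (f v) (f v) :=
    isIdempotentElem_rankOne_self hy
  have hCv : rankOne ℂ v v * C = 0 := by
    rw [← hΦ.mul_eq_zero_iff _ (rankOne_mem_Icc hv) _ hC, hCy, hf.map_rankOne v hv, mul_sub,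
      mul_one, hidem, sub_self]
  have hCle : C ≤ dampedAlong v u := by
    refine (le_one_sub_rankOne hC hv hCv).trans ?_
    rw [dampedAlong_eq v hu]
    exact le_add_of_nonneg_right (scaledRankOne_mem_Icc hv hu).1
  obtain ⟨w, hw, hBw⟩ := exists_eq_dampedAlong (hΦ.mapsTo _ hm) hy
    (hCy ▸ (hΦ.le_iff C hC _ hm).2 hCle) (by
      rw [← hCy]
      intro h
      rw [← hΦ.injOn hm hC h, dampedAlong_eq v hu, mul_add, mul_sub, mul_one,
        show rankOne ℂ v v * rankOne ℂ v v = rankOne ℂ v v from isIdempotentElem_rankOne_self hv,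
        sub_self, zero_add, scaledRankOne, mul_smul_comm,
        show rankOne ℂ v v * rankOne ℂ v v = rankOne ℂ v v from
          isIdempotentElem_rankOne_self hv] at hCv
      exact scaledRankOne_ne_zero hv hu hCv)
  have key (r : ℝ) (hr : 0 ≤ r) : u ≤ r ↔ w ≤ G v r := by
    have h1 := scaledRankOne_le_dampedAlong_iff hv hv hu hr
    have h2 := scaledRankOne_le_dampedAlong_iff hy hy hw (hf.nonneg v hv r hr)
    rw [inner_self_eq_one_of_norm hv, norm_one, one_pow, mul_one] at h1
    rw [inner_self_eq_one_of_norm hy, norm_one, one_pow, mul_one, ← hBw, ← hf.map_scaled v hv r hr,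
      hΦ.le_iff _ (scaledRankOne_mem_Icc hv hr) _ hm] at h2
    rw [← h1, h2]
  obtain ⟨r, hr, hrw⟩ := hf.surj hΦ hv hw
  have h1 : w ≤ G v u := (key u hu).1 le_rfl
  have h2 : u ≤ r := (key r hr).2 hrw.ge
  rw [hBw, le_antisymm h1 (hrw ▸ (hf.le_iff hΦ hv hu hr).2 h2)]

theorem mul_sq_inner_le_iff {x v : H} (hx : ‖x‖ = 1) (hv : ‖v‖ = 1) {u w : ℝ} (hu : 0 ≤ u)
    (hw : 0 ≤ w) :
    G v u * ‖inner ℂ (f x) (f v)‖ ^ 2 ≤ G x w ↔ u * ‖inner ℂ x v‖ ^ 2 ≤ w := by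
  rw [← scaledRankOne_le_dampedAlong_iff hx hv hu hw, ← hΦ.le_iff _ (scaledRankOne_mem_Icc hx hw) _
    (dampedAlong_mem_Icc hv hu), hf.map_dampedAlong hΦ hv hu, hf.map_scaled x hx w hw,
    scaledRankOne_le_dampedAlong_iff (hf.norm_eq x hx) (hf.norm_eq v hv) (hf.nonneg v hv u hu)
      (hf.nonneg x hx w hw)]

/-- The exchange law: both sides are the least value of `G x w` allowed by `mul_sq_inner_le_iff`,
since `G x` is an order isomorphism of the half-line. -/
theorem apply_mul_sq_inner {x v : H} (hx : ‖x‖ = 1) (hv : ‖v‖ = 1) {u : ℝ} (hu : 0 ≤ u) :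
    G x (u * ‖inner ℂ x v‖ ^ 2) = G v u * ‖inner ℂ (f x) (f v)‖ ^ 2 := by
  have h0 : 0 ≤ u * ‖inner ℂ x v‖ ^ 2 := by positivity
  obtain ⟨w, hw, hw'⟩ := hf.surj hΦ hx
    (mul_nonneg (hf.nonneg v hv u hu) (sq_nonneg ‖inner ℂ (f x) (f v)‖))
  refine le_antisymm ?_ ((hf.mul_sq_inner_le_iff hΦ hx hv hu h0).2 le_rfl)
  rw [← hw', hf.le_iff hΦ hx h0 hw]
  exact (hf.mul_sq_inner_le_iff hΦ hx hv hu hw).1 hw'.ge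

/-- The preimage of `1 - P_{f s} - P_{f t}` is annihilated by `P_s` and `P_t`, hence by `P_x`. So `f
x` lies in the span of `f s` and `f t`, and Pythagoras applies. -/
theorem sq_inner_add_sq_inner {x s t : H} (hx : ‖x‖ = 1) (hs : ‖s‖ = 1) (ht : ‖t‖ = 1)
    (hst : inner ℂ s t = 0) {a b : ℂ} (hab : x = a • s + b • t) :
    ‖inner ℂ (f x) (f s)‖ ^ 2 + ‖inner ℂ (f x) (f t)‖ ^ 2 = 1 := by
  have hs' := hf.norm_eq s hs
  have ht' := hf.norm_eq t ht
  have hx' := hf.norm_eq x hx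
  have hst' := (hf.inner_eq_zero_iff hΦ hs ht).2 hst
  have hts' : inner ℂ (f t) (f s) = 0 := by rw [← inner_conj_symm, hst', map_zero]
  have hD : 1 - rankOne ℂ (f s) (f s) - rankOne ℂ (f t) (f t) ∈ Set.Icc (0 : H →L[ℂ] H) 1 := by
    constructor
    · rw [sub_nonneg]
      refine le_one_sub_rankOne (rankOne_mem_Icc ht') hs' ?_
      rwa [rankOne_mul_rankOne_eq_zero_iff hs' ht']
    · exact (sub_le_self _ (rankOne_mem_Icc ht').1).trans (sub_le_self _ (rankOne_mem_Icc hs').1)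
  obtain ⟨C, hC, hCD⟩ := hΦ.surj _ hD
  have h1 : rankOne ℂ s s * C = 0 := by
    rw [← hΦ.mul_eq_zero_iff _ (rankOne_mem_Icc hs) _ hC, hCD, hf.map_rankOne s hs, mul_sub,
      mul_sub, mul_one, (rankOne_mul_rankOne_eq_zero_iff hs' ht').2 hst',
      show rankOne ℂ (f s) (f s) * rankOne ℂ (f s) (f s) = rankOne ℂ (f s) (f s) from
        isIdempotentElem_rankOne_self hs', sub_self, sub_zero]
  have h2 : rankOne ℂ t t * C = 0 := by
    rw [← hΦ.mul_eq_zero_iff _ (rankOne_mem_Icc ht) _ hC, hCD, hf.map_rankOne t ht, mul_sub,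
      mul_sub, mul_one, (rankOne_mul_rankOne_eq_zero_iff ht' hs').2 hts',
      show rankOne ℂ (f t) (f t) * rankOne ℂ (f t) (f t) = rankOne ℂ (f t) (f t) from
        isIdempotentElem_rankOne_self ht', sub_zero, sub_self]
  have h3 : rankOne ℂ x x * C = 0 := by
    rw [rankOne_mul_eq_zero_iff hx]
    intro z
    rw [hab, inner_add_left, inner_smul_left, inner_smul_left,
      (rankOne_mul_eq_zero_iff hs C).1 h1 z, (rankOne_mul_eq_zero_iff ht C).1 h2 z]
    simp
  rw [← hΦ.mul_eq_zero_iff _ (rankOne_mem_Icc hx) _ hC, hCD, hf.map_rankOne x hx,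
    rankOne_mul_eq_zero_iff hx'] at h3
  have h4 := congrArg Complex.re (h3 (f x))
  have h5 := re_inner_smul_rankOne 1 (f s) (f x)
  have h6 := re_inner_smul_rankOne 1 (f t) (f x)
  simp only [one_smul, one_mul] at h5 h6
  rw [sub_apply, sub_apply, inner_sub_right, inner_sub_right, Complex.sub_re, Complex.sub_re, h5,
    h6, show (1 : H →L[ℂ] H) (f x) = f x from rfl, inner_self_eq_one_of_norm hx',
    Complex.one_re, Complex.zero_re, norm_inner_symm, norm_inner_symm (f t)] at h4
  linarith

end IsRayAction

end

/-! ### Transition probabilities are preserved and scales are multiplied by a constant. -/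

noncomputable section

open InnerProductSpace ContinuousLinearMap

theorem eq_self_of_monotoneOn_of_add {m : ℝ → ℝ} (hmono : MonotoneOn m (Set.Icc 0 1)) (h1 : m 1 = 1)
    (hadd : ∀ x y, 0 ≤ x → 0 ≤ y → x + y ≤ 1 → m (x + y) = m x + m y) {x : ℝ}
    (hx : x ∈ Set.Icc (0 : ℝ) 1) : m x = x := by
  rcases hx.2.eq_or_lt with rfl | hx1
  · exact h1
  have h0 : m 0 = 0 := by
    have := hadd 0 0 le_rfl le_rfl (by norm_num)
    rw [add_zero] at this
    linarith
  have hmul (n : ℕ) (hn : 0 < n) (k : ℕ) : k ≤ n → m (k / n) = k * m (1 / n) := by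
    have hn' : (0 : ℝ) < n := by exact_mod_cast hn
    induction k with
    | zero => simp [h0]
    | succ k ih =>
      intro hk
      have hk' : ((k + 1 : ℕ) : ℝ) ≤ n := by exact_mod_cast hk
      push_cast at hk' ⊢
      rw [add_div, hadd _ _ (by positivity) (by positivity)
        (by rw [← add_div, div_le_one hn']; exact hk'), ih (by omega)]
      ring
  have hrat (n : ℕ) (hn : 0 < n) (k : ℕ) (hk : k ≤ n) : m (k / n) = k / n := by
    have hn' : (n : ℝ) ≠ 0 := by positivity
    have h2 := hmul n hn n le_rfl
    rw [div_self hn', h1] at h2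
    rw [hmul n hn k hk, eq_div_iff hn', mul_assoc, mul_comm (m _), ← h2, mul_one]
  -- Monotonicity traps both `x` and `m x` between the consecutive fractions `k / (n + 1)` and `(k +
  -- 1) / (n + 1)`, where `m` is already known.
  have hclose (n : ℕ) : |m x - x| ≤ 1 / ((n : ℝ) + 1) := by
    have hn' : (0 : ℝ) < (n : ℝ) + 1 := by positivity
    set k := ⌊((n : ℝ) + 1) * x⌋₊ with hk
    have hk1 : (k : ℝ) ≤ ((n : ℝ) + 1) * x := Nat.floor_le (mul_nonneg hn'.le hx.1)
    have hk2 : ((n : ℝ) + 1) * x < k + 1 := Nat.lt_floor_add_one _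
    have hkn : k < n + 1 := by
      have : (k : ℝ) < ((n + 1 : ℕ) : ℝ) := by push_cast; nlinarith
      exact_mod_cast this
    have e1 := hrat (n + 1) n.succ_pos k hkn.le
    have e2 := hrat (n + 1) n.succ_pos (k + 1) hkn
    push_cast at e1 e2
    have l1 : (k : ℝ) / (n + 1) ≤ x := by rw [div_le_iff₀ hn']; linarith
    have l2 : x ≤ (k + 1 : ℝ) / (n + 1) := by rw [le_div_iff₀ hn']; linarith
    have hkn' : (k : ℝ) + 1 ≤ n + 1 := by exact_mod_cast hkn
    have m1 := hmono ⟨by positivity, l1.trans hx.2⟩ hx l1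
    have m2 := hmono hx ⟨by positivity, by rw [div_le_one hn']; exact hkn'⟩ l2
    rw [e1] at m1
    rw [e2] at m2
    rw [add_div] at l2 m2
    rw [abs_le]
    constructor <;> linarith
  by_contra hne
  have hpos : 0 < |m x - x| := abs_pos.2 (sub_ne_zero.2 hne)
  obtain ⟨n, hn⟩ := exists_nat_one_div_lt hpos
  exact absurd (hclose n) (not_le.2 hn)

variable {H : Type*} [NormedAddCommGroup H] [InnerProductSpace ℂ H]

theorem exists_norm_eq_one_inner_eq_zero (hdim : 2 ≤ Module.rank ℂ H) (x : H) :
    ∃ e : H, ‖e‖ = 1 ∧ inner ℂ x e = 0 := by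
  have hne : (Submodule.span ℂ {x})ᗮ ≠ ⊥ := by
    rw [Ne, Submodule.orthogonal_eq_bot_iff]
    intro h
    have h1 := rank_span_le (R := ℂ) ({x} : Set H)
    rw [h, rank_top, Cardinal.mk_singleton] at h1
    exact absurd (hdim.trans h1) (by norm_num)
  obtain ⟨y, hy, hy0⟩ := Submodule.exists_mem_ne_zero_of_ne_bot hne
  have hxy : inner ℂ x y = 0 := Submodule.mem_orthogonal_singleton_iff_inner_right.1 hy
  refine ⟨((‖y‖⁻¹ : ℝ) : ℂ) • y, ?_, by rw [inner_smul_right, hxy, mul_zero]⟩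
  rw [norm_smul, Complex.norm_real, norm_inv, norm_norm, inv_mul_cancel₀ (norm_ne_zero_iff.2 hy0)]

/-- Rotating the pair `x, e` realises every transition probability in `[0, 1]`. -/
theorem exists_orthonormal_pair {x e : H} (hx : ‖x‖ = 1) (he : ‖e‖ = 1) (hxe : inner ℂ x e = 0)
    {r : ℝ} (hr : r ∈ Set.Icc (0 : ℝ) 1) :
    ∃ s t : H, ‖s‖ = 1 ∧ ‖t‖ = 1 ∧ inner ℂ s t = 0 ∧ (∃ a b : ℂ, x = a • s + b • t) ∧
      ‖inner ℂ x s‖ ^ 2 = r ∧ ‖inner ℂ x t‖ ^ 2 = 1 - r ∧ ‖inner ℂ e s‖ ^ 2 = 1 - r := by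
  have hex : inner ℂ e x = 0 := by rw [← inner_conj_symm, hxe, map_zero]
  have hxx := inner_self_eq_one_of_norm hx
  have hee := inner_self_eq_one_of_norm he
  obtain ⟨a, ha0, ha⟩ : ∃ a : ℝ, 0 ≤ a ∧ a ^ 2 = r := ⟨√r, by positivity, Real.sq_sqrt hr.1⟩
  obtain ⟨b, hb0, hb⟩ : ∃ b : ℝ, 0 ≤ b ∧ b ^ 2 = 1 - r :=
    ⟨√(1 - r), by positivity, Real.sq_sqrt (sub_nonneg.2 hr.2)⟩
  have hab : (a : ℂ) * a + b * b = 1 := by norm_cast; nlinarith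
  have hn {y : H} (hy : inner ℂ y y = (1 : ℂ)) : ‖y‖ = 1 := by
    rw [inner_self_eq_norm_sq_to_K] at hy
    have : ‖y‖ ^ 2 = 1 := Complex.ofReal_injective (by simpa using hy)
    nlinarith [norm_nonneg y]
  refine ⟨(a : ℂ) • x + (b : ℂ) • e, (b : ℂ) • x - (a : ℂ) • e, hn ?_, hn ?_, ?_,
    ⟨a, b, ?_⟩, ?_, ?_, ?_⟩
  · simp only [inner_add_left, inner_add_right, inner_smul_left, inner_smul_right, hxx, hee, hxe,
      hex, Complex.conj_ofReal]
    linear_combination hab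
  · simp only [inner_sub_left, inner_sub_right, inner_smul_left, inner_smul_right, hxx, hee, hxe,
      hex, Complex.conj_ofReal]
    linear_combination hab
  · simp only [inner_add_left, inner_sub_right, inner_smul_left, inner_smul_right, hxx, hee, hxe,
      hex, Complex.conj_ofReal]
    ring
  · have : x = ((a : ℂ) * a + b * b) • x := by rw [hab, one_smul]
    nth_rw 1 [this]
    module
  · rw [inner_add_right, inner_smul_right, inner_smul_right, hxx, hxe]
    simp [ha]
  · rw [inner_sub_right, inner_smul_right, inner_smul_right, hxx, hxe]
    simp [hb]
  · rw [inner_add_right, inner_smul_right, inner_smul_right, hex, hee]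
    simp [hb]

namespace IsRayAction

variable [CompleteSpace H] {Φ : (H →L[ℂ] H) → (H →L[ℂ] H)} {f : H → H} {G : H → ℝ → ℝ}
  (hf : IsRayAction Φ f G) (hΦ : IsEffectAutomorphism Φ)
include hf hΦ

theorem apply_zero {x : H} (hx : ‖x‖ = 1) : G x 0 = 0 := by
  obtain ⟨u, hu, hu0⟩ := hf.surj hΦ hx le_rfl
  exact le_antisymm (hu0 ▸ (hf.le_iff hΦ hx le_rfl hu).2 hu) (hf.nonneg x hx 0 le_rfl)

theorem apply_pos {x : H} (hx : ‖x‖ = 1) {u : ℝ} (hu : 0 < u) : 0 < G x u := by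
  rw [← hf.apply_zero hΦ hx]
  exact lt_of_not_ge fun h => hu.not_ge ((hf.le_iff hΦ hx hu.le le_rfl).1 h)

/-- The exchange law from `x` to `v` and back, which eliminates `G v`. -/
theorem apply_mul_sq_sq_inner {x v : H} (hx : ‖x‖ = 1) (hv : ‖v‖ = 1) {u : ℝ} (hu : 0 ≤ u) :
    G x ((‖inner ℂ x v‖ ^ 2) ^ 2 * u) = (‖inner ℂ (f x) (f v)‖ ^ 2) ^ 2 * G x u := by
  have h1 := hf.apply_mul_sq_inner hΦ hx hv (u := u * ‖inner ℂ x v‖ ^ 2) (by positivity)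
  have h2 := hf.apply_mul_sq_inner hΦ hv hx hu
  rw [norm_inner_symm, norm_inner_symm (f v)] at h2
  rw [h2] at h1
  rw [show (‖inner ℂ x v‖ ^ 2) ^ 2 * u = u * ‖inner ℂ x v‖ ^ 2 * ‖inner ℂ x v‖ ^ 2 by ring, h1]
  ring

theorem sq_norm_inner (hdim : 2 ≤ Module.rank ℂ H) {x v : H} (hx : ‖x‖ = 1) (hv : ‖v‖ = 1) :
    ‖inner ℂ (f x) (f v)‖ ^ 2 = ‖inner ℂ x v‖ ^ 2 := by
  obtain ⟨e, he, hxe⟩ := exists_norm_eq_one_inner_eq_zero hdim x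
  have hG1 : 0 < G x 1 := hf.apply_pos hΦ hx one_pos
  -- Taking `u = 1` in `apply_mul_sq_sq_inner` forces this formula for the new transition
  -- probability in terms of the old one.
  set m : ℝ → ℝ := fun r => √(G x (r ^ 2) / G x 1) with hm
  have hmd {w : H} (hw : ‖w‖ = 1) : m (‖inner ℂ x w‖ ^ 2) = ‖inner ℂ (f x) (f w)‖ ^ 2 := by
    have h := hf.apply_mul_sq_sq_inner hΦ hx hw zero_le_one
    rw [mul_one] at h
    simp only [hm]
    rw [h, mul_div_assoc, div_self hG1.ne', mul_one, Real.sqrt_sq (by positivity)]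
  have hsum {r : ℝ} (hr : r ∈ Set.Icc (0 : ℝ) 1) : m r + m (1 - r) = 1 := by
    obtain ⟨s, t, hs, ht, hst, ⟨a, b, hab⟩, h1, h2, -⟩ := exists_orthonormal_pair hx he hxe hr
    rw [← h2, ← h1, hmd hs, hmd ht]
    exact hf.sq_inner_add_sq_inner hΦ hx hs ht hst hab
  have hmul {r q : ℝ} (hr : r ∈ Set.Icc (0 : ℝ) 1) : m (r * q) = m r * m q := by
    obtain ⟨s, t, hs, -, -, -, h1, -, -⟩ := exists_orthonormal_pair hx he hxe hr
    have h := hf.apply_mul_sq_sq_inner hΦ hx hs (sq_nonneg q)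
    rw [← hmd hs, h1, ← mul_pow] at h
    have hmr : 0 ≤ m r := Real.sqrt_nonneg _
    simp only [hm] at h hmr ⊢
    rw [h, mul_div_assoc, Real.sqrt_mul (sq_nonneg _), Real.sqrt_sq hmr]
  have hone : m 1 = 1 := by simp [hm, div_self hG1.ne']
  have hzero : m 0 = 0 := by
    have := hsum (r := 1) ⟨zero_le_one, le_rfl⟩
    rw [hone, sub_self] at this
    linarith
  have hmono : MonotoneOn m (Set.Icc 0 1) := by
    intro a ha b hb hab
    refine Real.sqrt_le_sqrt (div_le_div_of_nonneg_right ?_ hG1.le)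
    exact (hf.le_iff hΦ hx (sq_nonneg a) (sq_nonneg b)).2 (pow_le_pow_left₀ ha.1 hab 2)
  -- Multiplicativity extracts the factor `m (a + b)`, leaving two arguments that sum to `1`.
  have hadd (a b : ℝ) (ha : 0 ≤ a) (hb : 0 ≤ b) (hab : a + b ≤ 1) : m (a + b) = m a + m b := by
    rcases (add_nonneg ha hb).eq_or_lt with h0 | h0
    · have ha' : a = 0 := by linarith
      have hb' : b = 0 := by linarith
      simp [ha', hb', hzero]
    · have hd : a / (a + b) ∈ Set.Icc (0 : ℝ) 1 :=
        ⟨by positivity, by rw [div_le_one h0]; linarith⟩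
      have h1 := hsum hd
      have h2 : 1 - a / (a + b) = b / (a + b) := by field_simp; ring
      have h3 := hmul (r := a + b) (q := a / (a + b)) ⟨h0.le, hab⟩
      have h4 := hmul (r := a + b) (q := b / (a + b)) ⟨h0.le, hab⟩
      rw [mul_div_cancel₀ _ h0.ne'] at h3 h4
      rw [h2] at h1
      rw [h3, h4, ← mul_add, h1, mul_one]
  rw [← hmd hv]
  refine eq_self_of_monotoneOn_of_add hmono hone hadd ⟨sq_nonneg _, ?_⟩
  have := norm_inner_le_norm (𝕜 := ℂ) x v
  rw [hx, hv, one_mul] at this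
  nlinarith [norm_nonneg (inner ℂ x v)]

theorem apply_eq_mul (hdim : 2 ≤ Module.rank ℂ H) {x : H} (hx : ‖x‖ = 1) {u : ℝ} (hu : 0 ≤ u) :
    G x u = G x 1 * u := by
  obtain ⟨e, he, hxe⟩ := exists_norm_eq_one_inner_eq_zero hdim x
  have key {r w : ℝ} (hr : r ∈ Set.Icc (0 : ℝ) 1) (hw : 0 ≤ w) : G x (r * w) = r * G x w := by
    obtain ⟨s, t, hs, -, -, -, h1, -, -⟩ := exists_orthonormal_pair hx he hxe
      (r := √r) ⟨Real.sqrt_nonneg r, Real.sqrt_le_one.2 hr.2⟩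
    have h := hf.apply_mul_sq_sq_inner hΦ hx hs hw
    rwa [hf.sq_norm_inner hΦ hdim hx hs, h1, Real.sq_sqrt hr.1] at h
  rcases le_total u 1 with h | h
  · have := key (w := 1) ⟨hu, h⟩ zero_le_one
    rw [mul_one] at this
    rw [this, mul_comm]
  · have hu0 : u ≠ 0 := by positivity
    have := key (r := u⁻¹) ⟨by positivity, inv_le_one_of_one_le₀ h⟩ hu
    rw [inv_mul_cancel₀ hu0] at this
    rw [this]
    field_simp

theorem apply_one_eq_of_inner_ne_zero (hdim : 2 ≤ Module.rank ℂ H) {x v : H} (hx : ‖x‖ = 1)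
    (hv : ‖v‖ = 1) (hxv : inner ℂ x v ≠ 0) : G x 1 = G v 1 := by
  have h := hf.apply_mul_sq_inner hΦ hx hv zero_le_one
  rw [one_mul, hf.sq_norm_inner hΦ hdim hx hv, hf.apply_eq_mul hΦ hdim hx (by positivity)] at h
  exact mul_right_cancel₀ (by positivity) h

theorem exists_forall_apply_eq_mul (hdim : 2 ≤ Module.rank ℂ H) :
    ∃ k : ℝ, 0 < k ∧ ∀ x : H, ‖x‖ = 1 → ∀ u : ℝ, 0 ≤ u → G x u = k * u := by
  obtain ⟨e, he, -⟩ := exists_norm_eq_one_inner_eq_zero hdim (0 : H)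
  refine ⟨G e 1, hf.apply_pos hΦ he one_pos, fun x hx u hu => ?_⟩
  rw [hf.apply_eq_mul hΦ hdim hx hu]
  congr 1
  by_cases hxe : inner ℂ x e = 0
  -- Orthogonal vectors are compared through a vector halfway between them, orthogonal to neither.
  · obtain ⟨s, t, hs, -, -, -, h1, -, h2⟩ := exists_orthonormal_pair hx he hxe
      (r := 1 / 2) ⟨by norm_num, by norm_num⟩
    have h3 : inner ℂ x s ≠ 0 := fun h => by norm_num [h] at h1
    have h4 : inner ℂ e s ≠ 0 := fun h => by norm_num [h] at h2
    rw [hf.apply_one_eq_of_inner_ne_zero hΦ hdim hx hs h3,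
      hf.apply_one_eq_of_inner_ne_zero hΦ hdim he hs h4]
  · exact hf.apply_one_eq_of_inner_ne_zero hΦ hdim hx he hxe

end IsRayAction

end

/-! ### Wigner's theorem. -/

noncomputable section

open InnerProductSpace ContinuousLinearMap

section Wigner

variable {K H : Type*} [NormedAddCommGroup K] [InnerProductSpace ℂ K]
  [NormedAddCommGroup H] [InnerProductSpace ℂ H]

theorem re_inner_self_eq_norm_sq (x : H) : (inner ℂ x x).re = ‖x‖ ^ 2 := by
  simpa using inner_self_eq_norm_sq (𝕜 := ℂ) x

theorem map_add_of_re_inner_eq {V : K → H}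
    (h : ∀ x y, (inner ℂ (V x) (V y)).re = (inner ℂ x y).re) (x y : K) :
    V (x + y) = V x + V y := by
  rw [← sub_eq_zero, ← norm_eq_zero, ← sq_eq_zero_iff, ← re_inner_self_eq_norm_sq]
  simp only [inner_sub_left, inner_sub_right, inner_add_left, inner_add_right, Complex.sub_re,
    Complex.add_re, h]
  ring

theorem map_real_smul_of_re_inner_eq {V : K → H}
    (h : ∀ x y, (inner ℂ (V x) (V y)).re = (inner ℂ x y).re) (r : ℝ) (x : K) :
    V ((r : ℂ) • x) = (r : ℂ) • V x := by
  rw [← sub_eq_zero, ← norm_eq_zero, ← sq_eq_zero_iff, ← re_inner_self_eq_norm_sq]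
  simp only [inner_sub_left, inner_sub_right, inner_smul_left, inner_smul_right, Complex.sub_re,
    Complex.conj_ofReal, Complex.re_ofReal_mul, h]
  ring

/-- The inner product of `V x` with `V (i x)` has real part `0` and modulus `‖x‖²`, so it is `± i
‖x‖²`: equality in Cauchy–Schwarz. -/
theorem map_I_smul_of_re_inner_eq {V : K → H}
    (h : ∀ x y, (inner ℂ (V x) (V y)).re = (inner ℂ x y).re)
    (h' : ∀ x y, ‖inner ℂ (V x) (V y)‖ = ‖inner ℂ x y‖) (x : K) :
    V (Complex.I • x) = Complex.I • V x ∨ V (Complex.I • x) = -Complex.I • V x := by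
  have h1 := h x (Complex.I • x)
  have h2 := h' x (Complex.I • x)
  have hx : inner ℂ x x = ((‖x‖ ^ 2 : ℝ) : ℂ) := by
    rw [inner_self_eq_norm_sq_to_K]; simp
  rw [inner_smul_right, hx] at h1 h2
  rw [norm_mul, Complex.norm_I, one_mul, Complex.norm_real, Real.norm_of_nonneg (sq_nonneg _),
    Complex.norm_eq_sqrt_sq_add_sq, h1] at h2
  have h4 : (inner ℂ (V x) (V (Complex.I • x))).im ^ 2 = (‖x‖ ^ 2) ^ 2 := by
    rw [← h2, Real.sq_sqrt (by positivity), Complex.I_mul_re, Complex.ofReal_im]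
    ring
  have hn (y : K) : ‖V y‖ ^ 2 = ‖y‖ ^ 2 := by
    rw [← re_inner_self_eq_norm_sq, h, re_inner_self_eq_norm_sq]
  have h5 (s : ℂ) : ‖V (Complex.I • x) - s • V x‖ ^ 2 =
      ‖x‖ ^ 2 + ‖s‖ ^ 2 * ‖x‖ ^ 2 - 2 * (conj s * inner ℂ (V x) (V (Complex.I • x))).re := by
    rw [@norm_sub_sq ℂ, hn, norm_smul, norm_smul, mul_pow, mul_pow, hn, inner_re_symm,
      inner_smul_left, Complex.norm_I]
    simp only [RCLike.re_to_complex]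
    ring
  rcases sq_eq_sq_iff_eq_or_eq_neg.1 h4 with h6 | h6
  · left
    rw [← sub_eq_zero, ← norm_eq_zero, ← sq_eq_zero_iff, h5]
    simp [Complex.mul_re, h6]
    ring
  · right
    rw [← sub_eq_zero, ← norm_eq_zero, ← sq_eq_zero_iff, h5]
    simp [Complex.mul_re, h6]
    ring

theorem forall_map_smul_or_forall_map_conj_smul {V : K → H}
    (h : ∀ x y, (inner ℂ (V x) (V y)).re = (inner ℂ x y).re)
    (h' : ∀ x y, ‖inner ℂ (V x) (V y)‖ = ‖inner ℂ x y‖) :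
    (∀ (c : ℂ) x, V (c • x) = c • V x) ∨ ∀ (c : ℂ) x, V (c • x) = conj c • V x := by
  have hdec (c : ℂ) (x : K) :
      V (c • x) = (c.re : ℂ) • V x + (c.im : ℂ) • V (Complex.I • x) := by
    rw [← map_real_smul_of_re_inner_eq h, ← map_real_smul_of_re_inner_eq h,
      ← map_add_of_re_inner_eq h, smul_smul, ← add_smul, Complex.re_add_im]
  -- The sign does not depend on the vector: if `x` and `y` had opposite signs, additivity would
  -- leave none for `x + y`.
  have hI : (∀ x, V (Complex.I • x) = Complex.I • V x) ∨
      ∀ x, V (Complex.I • x) = -Complex.I • V x := by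
    by_contra! hcon
    obtain ⟨⟨x, hx⟩, y, hy⟩ := hcon
    have hx' := (map_I_smul_of_re_inner_eq h h' x).resolve_left hx
    have hy' := (map_I_smul_of_re_inner_eq h h' y).resolve_right hy
    have hxy := map_I_smul_of_re_inner_eq h h' (x + y)
    rw [smul_add, map_add_of_re_inner_eq h, map_add_of_re_inner_eq h, smul_add, smul_add] at hxy
    rcases hxy with hxy | hxy
    · rw [hy', add_left_inj] at hxy
      exact hx hxy
    · rw [hx', add_right_inj] at hxy
      exact hy hxy
  refine hI.imp (fun hI c x => ?_) (fun hI c x => ?_)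
  · rw [hdec, hI, smul_smul, ← add_smul, Complex.re_add_im]
  · rw [hdec, hI, smul_smul, ← add_smul]
    congr 1
    apply Complex.ext <;> simp

theorem exists_norm_eq_one_eq_smul {a b : H} (hab : ‖a‖ = ‖b‖) (h : ‖inner ℂ a b‖ = ‖a‖ * ‖b‖) :
    ∃ c : ℂ, ‖c‖ = 1 ∧ b = c • a := by
  by_cases ha : a = 0
  · refine ⟨1, norm_one, ?_⟩
    rw [ha, norm_zero] at hab
    rw [ha, smul_zero, ← norm_eq_zero, hab]
  · have hb : b ≠ 0 := by rwa [← norm_ne_zero_iff, ← hab, norm_ne_zero_iff]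
    obtain ⟨r, -, rfl⟩ := (norm_inner_eq_norm_iff ha hb).1 h
    refine ⟨r, ?_, rfl⟩
    rw [norm_smul] at hab
    exact mul_right_cancel₀ (norm_ne_zero_iff.2 ha) (by rw [one_mul, ← hab])

/-- Fix the phase of `F (e + x)` by making its `F e` coefficient `1`, and let `V x` be the rest.
Then both `|1 + ⟨V x, V y⟩|` and `|⟨V x, V y⟩|` are preserved, which determines the real part. -/
theorem exists_affine_chart {F : H → H} (hF : ∀ x y, ‖inner ℂ (F x) (F y)‖ = ‖inner ℂ x y‖) {e : H}
    (he : ‖e‖ = 1) : ∃ V : (Submodule.span ℂ {e})ᗮ → H,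
      (∀ x, inner ℂ (F e) (V x) = 0) ∧
      (∀ x, ∃ c : ℂ, ‖c‖ = 1 ∧ F e + V x = c • F (e + x)) ∧
      (∀ x, ∃ c : ℂ, ‖c‖ = 1 ∧ V x = c • F x) ∧
      (∀ x y, (inner ℂ (V x) (V y)).re = (inner ℂ x y).re) ∧
      ∀ x y, ‖inner ℂ (V x) (V y)‖ = ‖inner ℂ x y‖ := by
  have hFn (x : H) : ‖F x‖ = ‖x‖ := by
    have := hF x x
    rw [inner_self_eq_norm_sq_to_K, inner_self_eq_norm_sq_to_K] at this
    simpa using this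
  have hee := inner_self_eq_one_of_norm he
  have hee' := inner_self_eq_one_of_norm ((hFn e).trans he)
  have hex (x : (Submodule.span ℂ {e})ᗮ) : inner ℂ e (x : H) = 0 :=
    Submodule.mem_orthogonal_singleton_iff_inner_right.1 x.2
  have hxe (x : (Submodule.span ℂ {e})ᗮ) : inner ℂ (x : H) e = 0 :=
    Submodule.mem_orthogonal_singleton_iff_inner_left.1 x.2
  have h1 (x : (Submodule.span ℂ {e})ᗮ) : ∃ v : H, inner ℂ (F e) v = 0 ∧
      ∃ c : ℂ, ‖c‖ = 1 ∧ F e + v = c • F (e + x) := by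
    set a := inner ℂ (F e) (F (e + x)) with ha
    have han : ‖a‖ = 1 := by
      rw [ha, hF, inner_add_right, hee, hex, add_zero, norm_one]
    have ha0 : a ≠ 0 := by rw [← norm_ne_zero_iff, han]; exact one_ne_zero
    refine ⟨a⁻¹ • F (e + x) - F e, ?_, a⁻¹, by rw [norm_inv, han, inv_one], by abel⟩
    rw [inner_sub_right, inner_smul_right, ← ha, hee', inv_mul_cancel₀ ha0, sub_self]
  choose V hV0 c hc hV using h1
  have hV0' (x : (Submodule.span ℂ {e})ᗮ) : inner ℂ (V x) (F e) = 0 := by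
    rw [← inner_conj_symm, hV0, map_zero]
  have hone (x y : (Submodule.span ℂ {e})ᗮ) : ‖1 + inner ℂ (V x) (V y)‖ = ‖1 + inner ℂ x y‖ := by
    have h2 : 1 + inner ℂ (V x) (V y) = inner ℂ (F e + V x) (F e + V y) := by
      rw [inner_add_left, inner_add_right, inner_add_right, hV0, hV0', hee']; ring
    have h3 : 1 + inner ℂ x y = inner ℂ (e + (x : H)) (e + (y : H)) := by
      rw [inner_add_left, inner_add_right, inner_add_right, hex, hxe, hee, Submodule.coe_inner]
      ring
    rw [h2, h3, hV, hV, inner_smul_left, inner_smul_right, norm_mul, norm_mul, RCLike.norm_conj, hc,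
      hc, one_mul, one_mul, hF]
  have hVn (x : (Submodule.span ℂ {e})ᗮ) : ‖V x‖ = ‖x‖ := by
    have h2 := hone x x
    rw [inner_self_eq_norm_sq_to_K, inner_self_eq_norm_sq_to_K] at h2
    have h3 (r : ℝ) : ‖(1 : ℂ) + (RCLike.ofReal r : ℂ) ^ 2‖ = 1 + r ^ 2 := by
      have : (1 : ℂ) + (RCLike.ofReal r : ℂ) ^ 2 = ((1 + r ^ 2 : ℝ) : ℂ) := by simp
      rw [this, Complex.norm_real, Real.norm_of_nonneg (by positivity)]
    rw [h3, h3] at h2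
    exact (sq_eq_sq₀ (norm_nonneg _) (norm_nonneg _)).1 (by linarith)
  have hVF (x : (Submodule.span ℂ {e})ᗮ) : ∃ c : ℂ, ‖c‖ = 1 ∧ V x = c • F x := by
    refine exists_norm_eq_one_eq_smul (by rw [hFn, hVn, Submodule.coe_norm]) ?_
    have h2 : inner ℂ (F x) (F e) = 0 := by
      rw [← norm_eq_zero, hF, hxe, norm_zero]
    have h3 : inner ℂ (F x) (V x) = inner ℂ (F x) (F e + V x) := by
      rw [inner_add_right, h2, zero_add]
    rw [h3, hV, inner_smul_right, norm_mul, hc, one_mul, hF, inner_add_right, hxe, zero_add, hFn,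
      hVn, inner_self_eq_norm_sq_to_K, Submodule.coe_norm]
    simp [sq]
  have habs (x y : (Submodule.span ℂ {e})ᗮ) : ‖inner ℂ (V x) (V y)‖ = ‖inner ℂ x y‖ := by
    obtain ⟨a, ha, hax⟩ := hVF x
    obtain ⟨b, hb, hby⟩ := hVF y
    rw [hax, hby, inner_smul_left, inner_smul_right, norm_mul, norm_mul, RCLike.norm_conj, ha, hb,
      one_mul, one_mul, hF, Submodule.coe_inner]
  refine ⟨V, hV0, fun x => ⟨c x, hc x, hV x⟩, hVF, fun x y => ?_, habs⟩
  have h2 (z : ℂ) : ‖1 + z‖ ^ 2 = 1 + 2 * z.re + ‖z‖ ^ 2 := by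
    rw [← Complex.normSq_eq_norm_sq, ← Complex.normSq_eq_norm_sq, Complex.normSq_apply,
      Complex.normSq_apply]
    simp
    ring
  have h3 := congrArg (· ^ 2) (hone x y)
  simp only [h2, habs] at h3
  linarith

theorem exists_semilinearIsometryEquiv {σ σ' : ℂ →+* ℂ} [RingHomInvPair σ σ'] [RingHomInvPair σ' σ]
    (hσ : ∀ c, ‖σ c‖ = ‖c‖) {F : H → H} (hF : ∀ x y, ‖inner ℂ (F x) (F y)‖ = ‖inner ℂ x y‖)
    (hsurj : ∀ y, ∃ x, ∃ c : ℂ, y = c • F x) {e : H}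
    (he : ‖e‖ = 1) {V : (Submodule.span ℂ {e})ᗮ → H}
    (hV0 : ∀ x, inner ℂ (F e) (V x) = 0)
    (hV1 : ∀ x, ∃ c : ℂ, ‖c‖ = 1 ∧ F e + V x = c • F (e + x))
    (hV2 : ∀ x, ∃ c : ℂ, ‖c‖ = 1 ∧ V x = c • F x)
    (hVre : ∀ x y, (inner ℂ (V x) (V y)).re = (inner ℂ x y).re)
    (hVσ : ∀ (c : ℂ) x, V (c • x) = σ c • V x) :
    ∃ U : H ≃ₛₗᵢ[σ] H, ∀ x, ∃ c : ℂ, ‖c‖ = 1 ∧ U x = c • F x := by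
  have hFn (x : H) : ‖F x‖ = ‖x‖ := by
    have := hF x x
    rw [inner_self_eq_norm_sq_to_K, inner_self_eq_norm_sq_to_K] at this
    simpa using this
  set p : H →ₗ[ℂ] (Submodule.span ℂ {e})ᗮ :=
    LinearMap.codRestrict _ (LinearMap.id - (innerSL ℂ e).toLinearMap.smulRight e) (fun z => by
      rw [Submodule.mem_orthogonal_singleton_iff_inner_right]
      exact inner_sub_inner_smul he z)
  have hpz (z : H) : (p z : H) = z - inner ℂ e z • e := rfl
  have hVn (x : (Submodule.span ℂ {e})ᗮ) : ‖V x‖ ^ 2 = ‖x‖ ^ 2 := by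
    rw [← re_inner_self_eq_norm_sq, hVre, re_inner_self_eq_norm_sq]
  have hnorm (a : ℂ) {b b' : H} (hb : inner ℂ b b' = 0) (hb1 : ‖b‖ = 1) :
      ‖a • b + b'‖ ^ 2 = ‖a‖ ^ 2 + ‖b'‖ ^ 2 := by
    rw [@norm_add_sq ℂ, inner_smul_left, hb, norm_smul, hb1]
    simp
  -- Extends `V` from the complement of `e` by sending `e` to `F e`. Off that complement, rescaling
  -- `z` to the form `e + x` shows that `U₀ z` lies on the line of `F z`.
  let U₀ : H →ₛₗᵢ[σ] H :=
    { toFun := fun z => σ (inner ℂ e z) • F e + V (p z)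
      map_add' := fun y z => by
        rw [inner_add_right, map_add, map_add, map_add_of_re_inner_eq hVre]
        module
      map_smul' := fun c z => by
        rw [inner_smul_right, map_mul, map_smul, hVσ]
        module
      norm_map' := fun z => by
        have hz : z = inner ℂ e z • e + (p z : H) := by rw [hpz]; abel
        have h0 : inner ℂ e (p z : H) = 0 := inner_sub_inner_smul he z
        have h1 : ‖σ (inner ℂ e z) • F e + V (p z)‖ ^ 2 = ‖z‖ ^ 2 := by
          rw [hnorm _ (hV0 _) ((hFn e).trans he), hσ, hVn]
          nth_rw 3 [hz]
          rw [hnorm _ h0 he, Submodule.coe_norm]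
        exact (sq_eq_sq₀ (norm_nonneg _) (norm_nonneg _)).1 h1 }
  have hU₀ (z : H) : U₀ z = σ (inner ℂ e z) • F e + V (p z) := rfl
  have hray (z : H) : ∃ c : ℂ, ‖c‖ = 1 ∧ U₀ z = c • F z := by
    suffices h : ∃ c : ℂ, U₀ z = c • F z by
      obtain ⟨c, hc⟩ := h
      refine exists_norm_eq_one_eq_smul (by rw [hFn, U₀.norm_map]) ?_
      have h1 : ‖c‖ * ‖F z‖ = ‖F z‖ := by rw [← norm_smul, ← hc, U₀.norm_map, hFn]
      rw [hc, inner_smul_right, norm_mul, norm_smul, inner_self_eq_norm_sq_to_K]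
      simp
      ring
    by_cases ha : inner ℂ e z = 0
    · obtain ⟨c, -, hc⟩ := hV2 (p z)
      refine ⟨c, ?_⟩
      rw [hU₀, ha, map_zero, zero_smul, zero_add, hc, hpz, ha, zero_smul, sub_zero]
    · set a := inner ℂ e z with hadef
      obtain ⟨c, -, hc⟩ := hV1 (a⁻¹ • p z)
      have hz : e + ((a⁻¹ • p z : (Submodule.span ℂ {e})ᗮ) : H) = a⁻¹ • z := by
        rw [Submodule.coe_smul, hpz, ← hadef, smul_sub, inv_smul_smul₀ ha]; abel
      rw [hz, hVσ] at hc
      have hσa : σ a * σ a⁻¹ = 1 := by rw [← map_mul, mul_inv_cancel₀ ha, map_one]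
      have h1 : U₀ z = (σ a * c) • F (a⁻¹ • z) := by
        rw [mul_smul, ← hc, smul_add, smul_smul, hσa, one_smul, hU₀]
      obtain ⟨d, -, hd⟩ := exists_norm_eq_one_eq_smul (a := a⁻¹ • F z) (b := F (a⁻¹ • z))
        (by rw [norm_smul, hFn, hFn, norm_smul])
        (by
          rw [inner_smul_left, norm_mul, hF, inner_smul_right, norm_mul, norm_smul, hFn, hFn,
            norm_smul, RCLike.norm_conj, inner_self_eq_norm_sq_to_K]
          simp
          ring)
      exact ⟨σ a * c * (d * a⁻¹), by rw [h1, hd, smul_smul, smul_smul, mul_assoc (σ a * c)]⟩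
  have hbij : Function.Surjective U₀ := by
    intro y
    obtain ⟨x, c, rfl⟩ := hsurj y
    obtain ⟨d, hd, hdx⟩ := hray x
    have hd0 : d ≠ 0 := by rw [← norm_ne_zero_iff, hd]; exact one_ne_zero
    refine ⟨σ' (c * d⁻¹) • x, ?_⟩
    rw [U₀.map_smulₛₗ, hdx, RingHomInvPair.comp_apply_eq₂, smul_smul, mul_assoc,
      inv_mul_cancel₀ hd0, mul_one]
  exact ⟨LinearIsometryEquiv.ofSurjective U₀ hbij, hray⟩

/-- **Wigner's theorem** for a transformation that is surjective up to scalars. -/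
theorem exists_unitary_or_antiunitary {F : H → H}
    (hF : ∀ x y, ‖inner ℂ (F x) (F y)‖ = ‖inner ℂ x y‖)
    (hsurj : ∀ y, ∃ x, ∃ c : ℂ, y = c • F x) {e : H} (he : ‖e‖ = 1) :
    (∃ U : H ≃ₗᵢ[ℂ] H, ∀ x, ∃ c : ℂ, ‖c‖ = 1 ∧ U x = c • F x) ∨
      ∃ U : H ≃ₗᵢ⋆[ℂ] H, ∀ x, ∃ c : ℂ, ‖c‖ = 1 ∧ U x = c • F x := by
  obtain ⟨V, h0, h1, h2, hre, habs⟩ := exists_affine_chart hF he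
  rcases forall_map_smul_or_forall_map_conj_smul hre habs with h | h
  · exact Or.inl (exists_semilinearIsometryEquiv (fun c => rfl) hF hsurj he h0 h1 h2 hre h)
  · exact Or.inr (exists_semilinearIsometryEquiv (fun c => RCLike.norm_conj c) hF hsurj he h0 h1 h2
      hre h)

end Wigner

end

/-! ### The functions `f_p`, unitary conjugation, and the conclusion. -/

noncomputable section

section EffectFun

variable {A : Type*} [CStarAlgebra A] [PartialOrder A] [StarOrderedRing A]

theorem spectrum_subset_Icc_of_mem_Icc {a : A} (ha : a ∈ Set.Icc (0 : A) 1) :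
    spectrum ℝ a ⊆ Set.Icc 0 1 := by
  have hsa : IsSelfAdjoint a := ha.1.isSelfAdjoint
  intro x hx
  have h0 := ha.1
  have h1 := ha.2
  rw [← cfc_id' ℝ a, cfc_nonneg_iff _ a] at h0
  rw [← cfc_id' ℝ a, cfc_le_one_iff _ a] at h1
  exact ⟨h0 x hx, h1 x hx⟩

theorem effectFun_denom_pos {p : ℝ} (hp : p < 1) {x : ℝ} (hx : x ∈ Set.Icc (0 : ℝ) 1) :
    0 < x * p + (1 - p) := by
  rcases hx.1.eq_or_lt with rfl | h0
  · linarith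
  · nlinarith [mul_nonneg (sub_nonneg.2 hx.2) (sub_nonneg.2 hp.le)]

theorem effectFun_mem_Icc {p : ℝ} (hp : p < 1) {x : ℝ} (hx : x ∈ Set.Icc (0 : ℝ) 1) :
    effectFun p x ∈ Set.Icc (0 : ℝ) 1 := by
  have h := effectFun_denom_pos hp hx
  refine ⟨div_nonneg hx.1 h.le, (div_le_one h).2 ?_⟩
  nlinarith [mul_nonneg (sub_nonneg.2 hx.2) (sub_nonneg.2 hp.le)]

theorem effectFun_effectFun {p q : ℝ} (hp : p < 1) (hpq : (1 - q) * (1 - p) = 1) {x : ℝ}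
    (hx : x ∈ Set.Icc (0 : ℝ) 1) : effectFun q (effectFun p x) = x := by
  have h := (effectFun_denom_pos hp hx).ne'
  have h1 : effectFun p x * q + (1 - q) = 1 / (x * p + (1 - p)) := by
    rw [effectFun]
    field_simp
    linear_combination (1 - x) * hpq
  rw [effectFun, h1, effectFun]
  field_simp

theorem continuousOn_effectFun {p : ℝ} (hp : p < 1) :
    ContinuousOn (effectFun p) (Set.Icc 0 1) :=
  ContinuousOn.div (by fun_prop) (by fun_prop) fun _ hx => (effectFun_denom_pos hp hx).ne'

theorem cfc_effectFun_mem_Icc {p : ℝ} (hp : p < 1) {a : A} (ha : a ∈ Set.Icc (0 : A) 1) :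
    cfc (effectFun p) a ∈ Set.Icc (0 : A) 1 :=
  ⟨cfc_nonneg fun _ hx => (effectFun_mem_Icc hp (spectrum_subset_Icc_of_mem_Icc ha hx)).1,
    cfc_le_one _ _ fun _ hx => (effectFun_mem_Icc hp (spectrum_subset_Icc_of_mem_Icc ha hx)).2⟩

theorem cfc_effectFun_cfc_effectFun {p q : ℝ} (hp : p < 1) (hq : q < 1)
    (hpq : (1 - q) * (1 - p) = 1) {a : A} (ha : a ∈ Set.Icc (0 : A) 1) :
    cfc (effectFun q) (cfc (effectFun p) a) = a := by
  have hsa : IsSelfAdjoint a := ha.1.isSelfAdjoint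
  have hs := spectrum_subset_Icc_of_mem_Icc ha
  rw [← cfc_comp (effectFun q) (effectFun p) a hsa
    ((continuousOn_effectFun hq).mono ?_) ((continuousOn_effectFun hp).mono hs)]
  · conv_rhs => rw [← cfc_id' ℝ a]
    exact cfc_congr fun x hx => effectFun_effectFun hp hpq (hs hx)
  · rintro _ ⟨x, hx, rfl⟩
    exact effectFun_mem_Icc hp (hs hx)

theorem cfc_effectFun_mul {p : ℝ} (hp : p < 1) {a : A} (ha : a ∈ Set.Icc (0 : A) 1) :
    ∃ T : Aˣ, (T : A) = p • a + (1 - p) • 1 ∧ 0 ≤ (T : A) ∧ cfc (effectFun p) a * T = a := by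
  have hsa : IsSelfAdjoint a := ha.1.isSelfAdjoint
  have hs := spectrum_subset_Icc_of_mem_Icc ha
  have hpos : ∀ x ∈ spectrum ℝ a, 0 < x * p + (1 - p) := fun x hx =>
    effectFun_denom_pos hp (hs hx)
  refine ⟨cfcUnits (fun x => x * p + (1 - p)) a fun x hx => (hpos x hx).ne', ?_, ?_, ?_⟩
  · change cfc (fun x => x * p + (1 - p)) a = _
    rw [cfc_add_const (1 - p) (fun x => x * p) a, Algebra.algebraMap_eq_smul_one]
    simp_rw [mul_comm _ p]
    rw [cfc_const_mul_id p a]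
  · change 0 ≤ cfc (fun x => x * p + (1 - p)) a
    exact cfc_nonneg fun x hx => (hpos x hx).le
  · change cfc (effectFun p) a * cfc (fun x => x * p + (1 - p)) a = a
    rw [← cfc_mul _ _ a ((continuousOn_effectFun hp).mono hs)]
    conv_rhs => rw [← cfc_id' ℝ a]
    exact cfc_congr fun x hx => div_mul_cancel₀ x (hpos x hx).ne'

/-- From `p f_p(x) = 1 - (1 - p) (p x + 1 - p)⁻¹` and antitonicity of the operator inverse. The sign
of `p` enters twice and cancels; `p = 0` is separate because `f_0` is the identity. -/
theorem cfc_effectFun_mono {p : ℝ} (hp : p < 1) {a b : A} (ha : a ∈ Set.Icc (0 : A) 1)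
    (hb : b ∈ Set.Icc (0 : A) 1) (hab : a ≤ b) : cfc (effectFun p) a ≤ cfc (effectFun p) b := by
  obtain ⟨S, hS, hS0, hSa⟩ := cfc_effectFun_mul hp ha
  obtain ⟨T, hT, hT0, hTb⟩ := cfc_effectFun_mul hp hb
  have key {c d : A} {R : Aˣ} (hR : (R : A) = p • c + (1 - p) • 1) (hd : d * R = c) :
      p • d = 1 - (1 - p) • (↑R⁻¹ : A) := by
    have h : p • d * R = (1 - (1 - p) • (↑R⁻¹ : A)) * R := by
      rw [sub_mul, smul_mul_assoc, smul_mul_assoc, hd, Units.inv_mul, one_mul, hR]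
      abel
    exact R.isUnit.mul_left_injective h
  have hp1 : 0 ≤ 1 - p := by linarith
  rcases lt_trichotomy p 0 with h | rfl | h
  · have hle : (T : A) ≤ S := by
      rw [hS, hT]
      exact add_le_add_left (smul_le_smul_of_nonpos_left hab h.le) _
    have h1 : p • cfc (effectFun p) b ≤ p • cfc (effectFun p) a := by
      rw [key hS hSa, key hT hTb]
      exact sub_le_sub_left (smul_le_smul_of_nonneg_left (CStarAlgebra.inv_le_inv hT0 hle) hp1) _
    exact (smul_le_smul_iff_of_neg_left h).1 h1
  · simp only [zero_smul, sub_zero, one_smul, zero_add] at hS hT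
    rw [hS, mul_one] at hSa
    rw [hT, mul_one] at hTb
    rwa [hSa, hTb]
  · have hle : (S : A) ≤ T := by
      rw [hS, hT]
      exact add_le_add_left (smul_le_smul_of_nonneg_left hab h.le) _
    have h1 : p • cfc (effectFun p) a ≤ p • cfc (effectFun p) b := by
      rw [key hS hSa, key hT hTb]
      exact sub_le_sub_left (smul_le_smul_of_nonneg_left (CStarAlgebra.inv_le_inv hS0 hle) hp1) _
    exact (smul_le_smul_iff_of_pos_left h).1 h1

theorem cfc_effectFun_le_iff {p : ℝ} (hp : p < 1) {a b : A} (ha : a ∈ Set.Icc (0 : A) 1)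
    (hb : b ∈ Set.Icc (0 : A) 1) : cfc (effectFun p) a ≤ cfc (effectFun p) b ↔ a ≤ b := by
  refine ⟨fun h => ?_, cfc_effectFun_mono hp ha hb⟩
  have hp1 : 0 < 1 - p := by linarith
  -- Since `1 - p` is multiplicative under composition, `f_q` with this `q` inverts `f_p`.
  have hq : 1 - (1 - p)⁻¹ < 1 := by
    have : 0 < (1 - p)⁻¹ := by positivity
    linarith
  have hpq : (1 - (1 - (1 - p)⁻¹)) * (1 - p) = 1 := by
    rw [sub_sub_cancel, inv_mul_cancel₀ hp1.ne']
  rw [← cfc_effectFun_cfc_effectFun hp hq hpq ha, ← cfc_effectFun_cfc_effectFun hp hq hpq hb]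
  exact cfc_effectFun_mono hq (cfc_effectFun_mem_Icc hp ha) (cfc_effectFun_mem_Icc hp hb) h

end EffectFun

open InnerProductSpace ContinuousLinearMap

variable {H : Type*} [NormedAddCommGroup H] [InnerProductSpace ℂ H]

theorem cfc_effectFun_scaledRankOne [CompleteSpace H] {p : ℝ} (hp : p < 1) {x : H} (hx : ‖x‖ = 1)
    {u : ℝ} (hu : 0 ≤ u) :
    cfc (effectFun p) (scaledRankOne x u) = scaledRankOne x ((1 - p) * u) := by
  obtain ⟨T, hT, -, h⟩ := cfc_effectFun_mul hp (scaledRankOne_mem_Icc hx hu)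
  refine T.isUnit.mul_left_injective ?_
  have hid : rankOne ℂ x x * rankOne ℂ x x = rankOne ℂ x x := isIdempotentElem_rankOne_self hx
  have hp1 : 0 < 1 - p := by linarith
  have h1 : 0 < 1 + u := by positivity
  have h2 : 0 < 1 + (1 - p) * u := by positivity
  dsimp only
  rw [h, hT, scaledRankOne, scaledRankOne]
  simp only [mul_add, mul_smul_comm, smul_mul_assoc, mul_one, hid, smul_smul, ← add_smul]
  congr 1
  field_simp
  ring

section UnitaryConj

variable {σ σ' : ℂ →+* ℂ} [RingHomInvPair σ σ'] [RingHomInvPair σ' σ]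

theorem unitaryConj_apply (U : H ≃ₛₗᵢ[σ] H) (B : H →L[ℂ] H) (z : H) :
    unitaryConj U B z = U (B (U.symm z)) := rfl

theorem unitaryConj_symm_unitaryConj (U : H ≃ₛₗᵢ[σ] H) (B : H →L[ℂ] H) :
    unitaryConj U.symm (unitaryConj U B) = B := by
  ext z
  simp [unitaryConj_apply]

variable [CompleteSpace H]

omit [CompleteSpace H] in
theorem unitaryConj_nonneg {U : H ≃ₛₗᵢ[σ] H} (hU : ∀ x y, inner ℂ (U x) (U y) = σ (inner ℂ x y))
    (hσ : ∀ r : ℝ, σ r = r) {B : H →L[ℂ] H} (hB : 0 ≤ B) : 0 ≤ unitaryConj U B := by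
  rw [nonneg_iff_isPositive, isPositive_iff_complex] at hB ⊢
  intro z
  obtain ⟨y, rfl⟩ := U.surjective z
  obtain ⟨h1, h2⟩ := hB y
  rw [unitaryConj_apply, U.symm_apply_apply, hU, ← h1, hσ]
  exact ⟨by simp, by simpa using h2⟩

omit [CompleteSpace H] in
theorem unitaryConj_sub (U : H ≃ₛₗᵢ[σ] H) (B C : H →L[ℂ] H) :
    unitaryConj U (B - C) = unitaryConj U B - unitaryConj U C := by
  ext z
  simp [unitaryConj_apply]

theorem unitaryConj_le {U : H ≃ₛₗᵢ[σ] H} (hU : ∀ x y, inner ℂ (U x) (U y) = σ (inner ℂ x y))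
    (hσ : ∀ r : ℝ, σ r = r) {B C : H →L[ℂ] H} (h : B ≤ C) :
    unitaryConj U B ≤ unitaryConj U C := by
  rw [← sub_nonneg, ← unitaryConj_sub]
  exact unitaryConj_nonneg hU hσ (sub_nonneg.2 h)

theorem unitaryConj_le_iff {U : H ≃ₛₗᵢ[σ] H} (hU : ∀ x y, inner ℂ (U x) (U y) = σ (inner ℂ x y))
    (hσ : ∀ r : ℝ, σ r = r) {B C : H →L[ℂ] H} :
    unitaryConj U B ≤ unitaryConj U C ↔ B ≤ C := by
  refine ⟨fun h => ?_, unitaryConj_le hU hσ⟩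
  have hU' (x y : H) : inner ℂ (U.symm x) (U.symm y) = σ' (inner ℂ x y) := by
    rw [← U.apply_symm_apply x, ← U.apply_symm_apply y, hU, U.symm_apply_apply, U.symm_apply_apply,
      RingHomInvPair.comp_apply_eq]
  have hσ' (r : ℝ) : σ' r = r := by
    rw [← hσ r, RingHomInvPair.comp_apply_eq, hσ]
  rw [← unitaryConj_symm_unitaryConj U B, ← unitaryConj_symm_unitaryConj U C]
  exact unitaryConj_le hU' hσ' h

omit [CompleteSpace H] in
theorem unitaryConj_scaledRankOne {U : H ≃ₛₗᵢ[σ] H}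
    (hU : ∀ x y, inner ℂ (U x) (U y) = σ (inner ℂ x y)) (hσ : ∀ r : ℝ, σ r = r) (x : H) (u : ℝ) :
    unitaryConj U (scaledRankOne x u) = scaledRankOne (U x) u := by
  ext z
  obtain ⟨y, rfl⟩ := U.surjective z
  rw [unitaryConj_apply, U.symm_apply_apply, scaledRankOne, scaledRankOne, smul_apply, smul_apply,
    ← Complex.coe_smul, ← Complex.coe_smul, rankOne_apply, rankOne_apply, hU,
    map_smulₛₗ, map_smulₛₗ, hσ]

theorem unitaryConj_mem_Icc {U : H ≃ₛₗᵢ[σ] H}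
    (hU : ∀ x y, inner ℂ (U x) (U y) = σ (inner ℂ x y)) (hσ : ∀ r : ℝ, σ r = r) {B : H →L[ℂ] H}
    (hB : B ∈ Set.Icc (0 : H →L[ℂ] H) 1) : unitaryConj U B ∈ Set.Icc (0 : H →L[ℂ] H) 1 := by
  refine ⟨unitaryConj_nonneg hU hσ hB.1, ?_⟩
  have h1 : unitaryConj U (1 : H →L[ℂ] H) = 1 := by
    ext z
    rw [unitaryConj_apply]
    exact U.apply_symm_apply z
  rw [← h1]
  exact unitaryConj_le hU hσ hB.2

omit [CompleteSpace H] in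
theorem inner_map_map_of_antiunitary (U : H ≃ₗᵢ⋆[ℂ] H) (x y : H) :
    inner ℂ (U x) (U y) = conj (inner ℂ x y) := by
  have hI (z : H) : Complex.I • U z = U (-(Complex.I • z)) := by
    rw [map_neg, map_smulₛₗ, Complex.conj_I, neg_smul, neg_neg]
  rw [inner_eq_sum_norm_sq_div_four, inner_eq_sum_norm_sq_div_four]
  simp only [RCLike.I_to_complex, hI, ← map_add, ← map_sub, U.norm_map]
  simp only [sub_neg_eq_add, ← sub_eq_add_neg]
  simp [map_ofNat (starRingEnd ℂ) 4]
  ring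

end UnitaryConj

variable [CompleteSpace H] {Φ : (H →L[ℂ] H) → (H →L[ℂ] H)} {f : H → H} {G : H → ℝ → ℝ}

/-- Both sides act alike on rank one effects and are order embeddings on effects, so they dominate
the same rank one effects. -/
theorem IsRayAction.eq_unitaryConj {σ σ' : ℂ →+* ℂ} [RingHomInvPair σ σ'] [RingHomInvPair σ' σ]
    (hf : IsRayAction Φ f G) (hΦ : IsEffectAutomorphism Φ) {k : ℝ} (hk : 0 < k)
    (hG : ∀ x : H, ‖x‖ = 1 → ∀ u : ℝ, 0 ≤ u → G x u = k * u) {U : H ≃ₛₗᵢ[σ] H}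
    (hU : ∀ x y, inner ℂ (U x) (U y) = σ (inner ℂ x y)) (hσ : ∀ r : ℝ, σ r = r)
    (hUf : ∀ x, ‖x‖ = 1 → ∃ c : ℂ, ‖c‖ = 1 ∧ U x = c • f x) {A : H →L[ℂ] H}
    (hA : A ∈ Set.Icc (0 : H →L[ℂ] H) 1) :
    Φ A = unitaryConj U (cfc (effectFun (1 - k)) A) := by
  have hp : 1 - k < 1 := by linarith
  have hfA := unitaryConj_mem_Icc hU hσ (cfc_effectFun_mem_Icc hp hA)
  have hΦA := hΦ.mapsTo A hA
  have key (y : H) (hy : ‖y‖ = 1) (w : ℝ) (hw : 0 ≤ w) : scaledRankOne y w ≤ Φ A ↔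
      scaledRankOne y w ≤ unitaryConj U (cfc (effectFun (1 - k)) A) := by
    obtain ⟨x, rfl⟩ := U.surjective y
    have hx : ‖x‖ = 1 := by rwa [U.norm_map] at hy
    obtain ⟨u, hu, rfl⟩ : ∃ u, 0 ≤ u ∧ k * u = w :=
      ⟨w / k, by positivity, mul_div_cancel₀ _ hk.ne'⟩
    have hm := scaledRankOne_mem_Icc hx hu
    have h1 : scaledRankOne (U x) (k * u) = Φ (scaledRankOne x u) := by
      obtain ⟨c, hc, hcx⟩ := hUf x hx
      rw [hf.map_scaled x hx u hu, hG x hx u hu, scaledRankOne, scaledRankOne, hcx,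
        rankOne_smul_self hc]
    have h2 := cfc_effectFun_scaledRankOne hp hx hu
    rw [sub_sub_cancel] at h2
    rw [← unitaryConj_scaledRankOne hU hσ, unitaryConj_le_iff hU hσ, ← h2,
      cfc_effectFun_le_iff hp hm hA, h2, unitaryConj_scaledRankOne hU hσ, h1,
      hΦ.le_iff _ hm A hA]
  exact le_antisymm
    (le_of_forall_scaledRankOne_le hΦA hfA.1 fun y hy w hw => (key y hy w hw).1)
    (le_of_forall_scaledRankOne_le hfA hΦA.1 fun y hy w hw => (key y hy w hw).2)

theorem IsRayAction.exists_unitary_or_antiunitary (hf : IsRayAction Φ f G)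
    (hΦ : IsEffectAutomorphism Φ) (hdim : 2 ≤ Module.rank ℂ H) :
    (∃ U : H ≃ₗᵢ[ℂ] H, ∀ x, ‖x‖ = 1 → ∃ c : ℂ, ‖c‖ = 1 ∧ U x = c • f x) ∨
      ∃ U : H ≃ₗᵢ⋆[ℂ] H, ∀ x, ‖x‖ = 1 → ∃ c : ℂ, ‖c‖ = 1 ∧ U x = c • f x := by
  obtain ⟨e, he, -⟩ := exists_norm_eq_one_inner_eq_zero hdim (0 : H)
  -- `f` is controlled only on unit vectors; Wigner's theorem needs its norm-preserving radial
  -- extension.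
  set F : H → H := fun x => (‖x‖ : ℂ) • f (((‖x‖⁻¹ : ℝ) : ℂ) • x) with hF
  have hunit {x : H} (hx : x ≠ 0) : ‖((‖x‖⁻¹ : ℝ) : ℂ) • x‖ = 1 := by
    rw [norm_smul, Complex.norm_real, norm_inv, norm_norm, inv_mul_cancel₀ (norm_ne_zero_iff.2 hx)]
  have hFf {x : H} (hx : ‖x‖ = 1) : F x = f x := by simp [hF, hx]
  have hinner {x v : H} (hx : ‖x‖ = 1) (hv : ‖v‖ = 1) :
      ‖inner ℂ (f x) (f v)‖ = ‖inner ℂ x v‖ :=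
    (sq_eq_sq₀ (norm_nonneg _) (norm_nonneg _)).1 (hf.sq_norm_inner hΦ hdim hx hv)
  have hFi (x y : H) : ‖inner ℂ (F x) (F y)‖ = ‖inner ℂ x y‖ := by
    by_cases hx : x = 0
    · simp [hF, hx]
    by_cases hy : y = 0
    · simp [hF, hy]
    have hx' := norm_ne_zero_iff.2 hx
    have hy' := norm_ne_zero_iff.2 hy
    simp only [hF]
    rw [inner_smul_left, inner_smul_right, norm_mul, norm_mul, hinner (hunit hx) (hunit hy),
      inner_smul_left, inner_smul_right, norm_mul, norm_mul]
    simp only [Complex.conj_ofReal, Complex.norm_real, norm_norm, norm_inv]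
    field_simp
  have hsurj (y : H) : ∃ x, ∃ c : ℂ, y = c • F x := by
    by_cases hy : y = 0
    · exact ⟨0, 0, by rw [hy, zero_smul]⟩
    obtain ⟨x, hx, hxy⟩ := hf.exists_rankOne_eq hΦ (hunit hy)
    have h1 := congrArg (fun T : H →L[ℂ] H => T (((‖y‖⁻¹ : ℝ) : ℂ) • y)) hxy
    simp only [rankOne_apply] at h1
    rw [inner_self_eq_one_of_norm (hunit hy), one_smul] at h1
    refine ⟨x, ‖y‖ * inner ℂ (f x) (((‖y‖⁻¹ : ℝ) : ℂ) • y), ?_⟩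
    rw [mul_smul, hFf hx, h1, smul_smul]
    norm_cast
    rw [mul_inv_cancel₀ (norm_ne_zero_iff.2 hy), one_smul]
  refine (_root_.exists_unitary_or_antiunitary hFi hsurj he).imp ?_ ?_
  all_goals
    rintro ⟨U, hU⟩
    exact ⟨U, fun x hx => hFf hx ▸ hU x⟩

/-- The extension by zero to all operators of a map of effects. -/
def extendEffectMap (φ : HilbertEffect H → HilbertEffect H) (A : H →L[ℂ] H) : H →L[ℂ] H :=
  open Classical in if h : A ∈ Set.Icc (0 : H →L[ℂ] H) 1 then φ ⟨A, h⟩ else 0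

omit [CompleteSpace H] in
theorem extendEffectMap_coe (φ : HilbertEffect H → HilbertEffect H) (A : HilbertEffect H) :
    extendEffectMap φ A = φ A := by
  rw [extendEffectMap, dif_pos A.2]

omit [CompleteSpace H] in
theorem isEffectAutomorphism_extendEffectMap {φ : HilbertEffect H → HilbertEffect H}
    (hsurj : Function.Surjective φ) (hord : PreservesOrderBoth φ)
    (hzero : PreservesZeroProductBoth φ) : IsEffectAutomorphism (extendEffectMap φ) where
  mapsTo A hA := by
    rw [extendEffectMap_coe φ ⟨A, hA⟩]
    exact (φ ⟨A, hA⟩).2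
  surj B hB := by
    obtain ⟨A, hA⟩ := hsurj ⟨B, hB⟩
    exact ⟨A, A.2, by rw [extendEffectMap_coe, hA]⟩
  le_iff A hA B hB := by
    rw [extendEffectMap_coe φ ⟨A, hA⟩, extendEffectMap_coe φ ⟨B, hB⟩]
    exact (hord ⟨A, hA⟩ ⟨B, hB⟩).symm
  mul_eq_zero_iff A hA B hB := by
    rw [extendEffectMap_coe φ ⟨A, hA⟩, extendEffectMap_coe φ ⟨B, hB⟩]
    exact (hzero ⟨A, hA⟩ ⟨B, hB⟩).symm

end

theorem mainTheorem1 {H : Type*} [NormedAddCommGroup H] [InnerProductSpace ℂ H] [CompleteSpace H]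
    (hdim : 2 ≤ Module.rank ℂ H) (φ : HilbertEffect H → HilbertEffect H)
    (hbij : Function.Bijective φ) (hord : PreservesOrderBoth φ)
    (hzero : PreservesZeroProductBoth φ) :
    ∃ p : ℝ, p < 1 ∧
      ((∃ U : H ≃ₗᵢ[ℂ] H, ∀ A : HilbertEffect H,
          (φ A : H →L[ℂ] H) = unitaryConj U (cfc (effectFun p) (A : H →L[ℂ] H))) ∨
        (∃ U : H ≃ₗᵢ⋆[ℂ] H, ∀ A : HilbertEffect H,
          (φ A : H →L[ℂ] H) = unitaryConj U (cfc (effectFun p) (A : H →L[ℂ] H)))) := by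
  have hΦ := isEffectAutomorphism_extendEffectMap hbij.surjective hord hzero
  obtain ⟨f, G, hf⟩ := hΦ.exists_isRayAction
  obtain ⟨k, hk, hG⟩ := hf.exists_forall_apply_eq_mul hΦ hdim
  refine ⟨1 - k, by linarith, ?_⟩
  rcases hf.exists_unitary_or_antiunitary hΦ hdim with ⟨U, hU⟩ | ⟨U, hU⟩
  · refine Or.inl ⟨U, fun A => ?_⟩
    rw [← extendEffectMap_coe]
    exact hf.eq_unitaryConj hΦ hk hG U.inner_map_map (fun _ => rfl) hU A.2
  · refine Or.inr ⟨U, fun A => ?_⟩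
    rw [← extendEffectMap_coe]
    exact hf.eq_unitaryConj hΦ hk hG (inner_map_map_of_antiunitary U) Complex.conj_ofReal hU A.2
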